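/- Let $G=\mathbb Z_7\times\mathbb Z_7$ (so $v=49$). A $(49,4,1)$ difference family in $G$ is a collection $F$ of $4$-subsets of $G$ (base blocks) such that every nonzero element of $G$ occurs exactly once among the differences $b-b'$ of ordered pairs of distinct elements $b,b'$ of the same base block. Its development is the set of all translates $B+g$ ($B\in F$, $g\in G$). Two difference families $F,F'$ are multiplier-equivalent if some automorphism $\alpha$ of the group $G$ carries $F$ to $F'$ up to translation of base blocks, i.e. carries the development of $F$ onto the development of $F'$. The multiplier of $F$ is the number of automorphisms of $G$ that fix $F$ up to translation of base blocks. In a Steiner system, the line $ab$ through distinct points $a,b$ is the block containing them. The fingerprint (hyperbolic frequency) of a Steiner system is $\{n=f_n\}$, where $f_n$ is the number of ordered quadruples of points $(o,x,y,p)$ such that $o,x,y$ do not lie on a common block, $p$ is on the line $xy$, $p\ne x,y$, and there are exactly $n$ points $u$ on the line $oy$ for which the line $pu$ does not meet the line $ox$; keys $n$ that are not displayed have $f_n=0$. Consider the following list (multiplier, fingerprint of the development, difference family): 1. $3$, $\{0=2646,\ 1=40572,\ 2=168462\}$, $\{\{(0,0),(0,1),(1,0),(3,6)\},\ \{(0,0),(0,2),(2,3),(3,4)\},\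 \{(0,0),(0,3),(1,5),(5,5)\},\ \{(0,0),(1,3),(2,0),(4,4)\}\}$ 2. $3$, $\{0=1764,\ 1=36456,\ 2=173460\}$, $\{\{(0,0),(0,1),(1,0),(3,6)\},\ \{(0,0),(0,2),(2,3),(3,4)\},\ \{(0,0),(0,3),(1,5),(5,5)\},\ \{(0,0),(1,3),(4,6),(6,3)\}\}$ 3. $3$, $\{0=1764,\ 1=37632,\ 2=172284\}$, $\{\{(0,0),(0,1),(1,0),(2,2)\},\ \{(0,0),(0,2),(1,3),(4,1)\},\ \{(0,0),(0,3),(2,0),(5,4)\},\ \{(0,0),(1,4),(3,2),(4,0)\}\}$ 4. $1$, $\{0=1764,\ 1=39984,\ 2=169932\}$, $\{\{(0,0),(0,1),(1,0),(2,2)\},\ \{(0,0),(0,2),(1,3),(4,1)\},\ \{(0,0),(0,3),(2,0),(5,4)\},\ \{(0,0),(1,4),(4,4),(5,2)\}\}$ 5. $3$, $\{0=882,\ 1=34692,\ 2=176106\}$, $\{\{(0,0),(0,1),(1,0),(2,2)\},\ \{(0,0),(0,2),(1,3),(4,1)\},\ \{(0,0),(0,3),(2,6),(5,3)\},\ \{(0,0),(1,4),(3,2),(4,0)\}\}$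 6. $1$, $\{0=1176,\ 1=37632,\ 2=172872\}$, $\{\{(0,0),(0,1),(1,0),(2,2)\},\ \{(0,0),(0,2),(1,3),(4,1)\},\ \{(0,0),(0,3),(2,6),(5,3)\},\ \{(0,0),(1,4),(4,4),(5,2)\}\}$ 7. $1$, $\{0=2058,\ 1=44100,\ 2=165522\}$, $\{\{(0,0),(0,1),(1,0),(2,2)\},\ \{(0,0),(0,2),(1,3),(5,4)\},\ \{(0,0),(0,3),(3,0),(4,5)\},\ \{(0,0),(1,4),(3,1),(5,1)\}\}$ 8. $1$, $\{0=882,\ 1=37044,\ 2=173754\}$, $\{\{(0,0),(0,1),(1,0),(2,2)\},\ \{(0,0),(0,2),(1,3),(5,4)\},\ \{(0,0),(0,3),(3,0),(4,5)\},\ \{(0,0),(1,4),(3,3),(5,3)\}\}$ 9. $3$, $\{0=10584,\ 1=76440,\ 2=124656\}$, $\{\{(0,0),(0,1),(1,0),(2,2)\},\ \{(0,0),(0,2),(1,3),(5,4)\},\ \{(0,0),(0,3),(3,5),(4,3)\},\ \{(0,0),(1,4),(3,3),(5,3)\}\}$ 10. $3$, $\{0=6174,\ 1=55860,\ 2=149646\}$,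 $\{\{(0,0),(0,1),(1,0),(2,2)\},\ \{(0,0),(0,2),(1,5),(4,4)\},\ \{(0,0),(0,3),(2,6),(4,3)\},\ \{(0,0),(1,1),(3,1),(6,3)\}\}$ 11. $1$, $\{0=5292,\ 1=48216,\ 2=158172\}$, $\{\{(0,0),(0,1),(1,0),(2,2)\},\ \{(0,0),(0,2),(1,5),(5,2)\},\ \{(0,0),(0,3),(3,2),(4,6)\},\ \{(0,0),(1,1),(3,0),(5,3)\}\}$ 12. $1$, $\{0=2352,\ 1=42336,\ 2=166992\}$, $\{\{(0,0),(0,1),(1,0),(2,2)\},\ \{(0,0),(0,2),(1,5),(5,2)\},\ \{(0,0),(0,3),(3,4),(4,1)\},\ \{(0,0),(1,1),(3,5),(5,1)\}\}$ Then each of the twelve collections is a $(49,4,1)$ difference family in $G$, its development is a Steiner system $S(2,4,49)$, and it has the stated multiplier and fingerprint. Every $(49,4,1)$ difference family in $G$ is multiplier-equivalent to one of the twelve. The twelve families are pairwise multiplier-inequivalent; moreover, the Steiner systems they generate are pairwise non-isomorphic (no bijection of the points carries the blocks of one onto the blocks of another). -/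

import Mathlib

open Finset

/-- The translate `B + g` of a block. -/
def translateBlock {G : Type*} [AddCommGroup G] [DecidableEq G] (B : Finset G) (g : G) : Finset G :=
  B.image (fun b => b + g)

/-- The multiplicity of `d ≠ 0` in the list of partial differences of `B`: the number of ordered
pairs `(b, b')` in `B × B` with `b - b' = d`, divided by the order of the translation stabilizer
of `B` (the stabilizer permutes these pairs freely, so the division is exact). -/
def partialDiffCount {G : Type*} [AddCommGroup G] [Fintype G] [DecidableEq G]
    (B : Finset G) (d : G) : ℕ :=
  #{q ∈ B ×ˢ B | q.1 - q.2 = d} / #{g : G | translateBlock B g = B}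

/-- `F` is a `(v, k, 1)` difference family in the group `G`: `G` has order `v`, the base blocks are
`k`-subsets of `G`, and every nonzero element of `G` occurs exactly once among their partial
differences. (As the index is `1`, no base block is repeated, so that a finite set of base blocks
is the right carrier.) -/
def IsDifferenceFamily {G : Type*} [AddCommGroup G] [Fintype G] [DecidableEq G]
    (v k : ℕ) (F : Finset (Finset G)) : Prop :=
  Fintype.card G = v ∧ (∀ B ∈ F, #B = k) ∧ ∀ d : G, d ≠ 0 → ∑ B ∈ F, partialDiffCount B d = 1

/-- The block set generated by `F`: all translates of its base blocks. -/
def development {G : Type*} [AddCommGroup G] [Fintype G] [DecidableEq G]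
    (F : Finset (Finset G)) : Finset (Finset G) :=
  F.biUnion fun B => univ.image fun g => translateBlock B g

/-- The image of a collection of blocks under a map of the points. -/
def mapBlocks {X Y : Type*} [DecidableEq Y] (f : X → Y) (F : Finset (Finset X)) :
    Finset (Finset Y) :=
  F.image fun B => B.image f

/-- Difference families represent their collection of base blocks up to translation. `F` and `F'`
are multiplier-equivalent if some group automorphism carries `F` to `F'` in this sense: it sends
every base block of `F` to a translate of a base block of `F'`, and all base blocks of `F'` arise
in this way up to translation. -/
def MultiplierEquivalent {G : Type*} [AddCommGroup G] [Fintype G] [DecidableEq G]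
    (F F' : Finset (Finset G)) : Prop :=
  ∃ α : G ≃+ G, development (mapBlocks α F) = development F'

/-- The multiplier of `F`: the number of automorphisms of the group that fix `F` (up to
translation of base blocks). -/
noncomputable def multiplierNumber {G : Type*} [AddCommGroup G] [Fintype G] [DecidableEq G]
    (F : Finset (Finset G)) : ℕ :=
  Nat.card {α : G ≃+ G // development (mapBlocks α F) = development F}

/-- The blocks `𝓑` form a Steiner system `S(2, k, v)` on the point set `X`. -/
def IsSteinerSystem {X : Type*} [Fintype X] (v k : ℕ) (𝓑 : Finset (Finset X)) : Prop :=
  Fintype.card X = v ∧ (∀ B ∈ 𝓑, #B = k) ∧ ∀ x y : X, x ≠ y → ∃! B, B ∈ 𝓑 ∧ x ∈ B ∧ y ∈ B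

/-- Isomorphism of block systems: a bijection of the points carrying blocks to blocks. -/
def BlocksIsomorphic {X Y : Type*} [DecidableEq Y]
    (𝓑 : Finset (Finset X)) (𝓒 : Finset (Finset Y)) : Prop :=
  ∃ e : X ≃ Y, mapBlocks e 𝓑 = 𝓒

/-- Three points lie on a common block. -/
def BlockCollinear {X : Type*} (𝓑 : Finset (Finset X)) (a b c : X) : Prop :=
  ∃ B ∈ 𝓑, a ∈ B ∧ b ∈ B ∧ c ∈ B

instance {X : Type*} [DecidableEq X] (𝓑 : Finset (Finset X)) (a b c : X) :
    Decidable (BlockCollinear 𝓑 a b c) :=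
  inferInstanceAs (Decidable (∃ B ∈ 𝓑, a ∈ B ∧ b ∈ B ∧ c ∈ B))

/-- The line through two distinct points `a`, `b`; in a Steiner system, the block on `a` and `b`. -/
def blockLine {X : Type*} [Fintype X] [DecidableEq X] (𝓑 : Finset (Finset X)) (a b : X) :
    Finset X :=
  {c : X | BlockCollinear 𝓑 a b c}

/-- The number of points `u` of the line `oy` such that the line `pu` does not meet the line `ox`.
It is used for non-collinear `o, x, y` and `p ≠ y` on the line `xy`, where `p` is not on `oy`, so
that `p ≠ u`. -/
def nonMeetingCount {X : Type*} [Fintype X] [DecidableEq X] (𝓑 : Finset (Finset X))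
    (o x y p : X) : ℕ :=
  #{u ∈ blockLine 𝓑 o y | Disjoint (blockLine 𝓑 p u) (blockLine 𝓑 o x)}

/-- The hyperbolic frequency fingerprint: `hyperbolicFrequency 𝓑 n` is the number of ordered
quadruples `(o, x, y, p)` with `o, x, y` non-collinear and `p` on the line `xy`, distinct from `x`
and `y`, whose `nonMeetingCount` is `n`. -/
def hyperbolicFrequency {X : Type*} [Fintype X] [DecidableEq X] (𝓑 : Finset (Finset X))
    (n : ℕ) : ℕ :=
  #{q : X × X × X × X | ¬ BlockCollinear 𝓑 q.1 q.2.1 q.2.2.1 ∧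
    q.2.2.2 ∈ blockLine 𝓑 q.2.1 q.2.2.1 ∧ q.2.2.2 ≠ q.2.1 ∧ q.2.2.2 ≠ q.2.2.1 ∧
    nonMeetingCount 𝓑 q.1 q.2.1 q.2.2.1 q.2.2.2 = n}

/-- The fingerprint `{0 = a, 1 = b, 2 = c}`; all other keys have frequency `0`. -/
def fingerprint (a b c : ℕ) : ℕ → ℕ
  | 0 => a
  | 1 => b
  | 2 => c
  | _ => 0

/-- A row of the list: multiplier, fingerprint, difference family in `ℤ₇ × ℤ₇`. -/
structure ListedFamily where
  multiplier : ℕ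
  frequency : ℕ → ℕ
  family : Finset (Finset (ZMod 7 × ZMod 7))

/-- The twelve listed difference families in `ℤ₇ × ℤ₇` with multipliers and fingerprints. -/
def listedFamilies : Fin 12 → ListedFamily :=
  ![
    { multiplier := 3, frequency := fingerprint 2646 40572 168462,
      family := {{(0, 0), (0, 1), (1, 0), (3, 6)},
        {(0, 0), (0, 2), (2, 3), (3, 4)},
        {(0, 0), (0, 3), (1, 5), (5, 5)},
        {(0, 0), (1, 3), (2, 0), (4, 4)}} },
    { multiplier := 3, frequency := fingerprint 1764 36456 173460,
      family := {{(0, 0), (0, 1), (1, 0), (3, 6)},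
        {(0, 0), (0, 2), (2, 3), (3, 4)},
        {(0, 0), (0, 3), (1, 5), (5, 5)},
        {(0, 0), (1, 3), (4, 6), (6, 3)}} },
    { multiplier := 3, frequency := fingerprint 1764 37632 172284,
      family := {{(0, 0), (0, 1), (1, 0), (2, 2)},
        {(0, 0), (0, 2), (1, 3), (4, 1)},
        {(0, 0), (0, 3), (2, 0), (5, 4)},
        {(0, 0), (1, 4), (3, 2), (4, 0)}} },
    { multiplier := 1, frequency := fingerprint 1764 39984 169932,
      family := {{(0, 0), (0, 1), (1, 0), (2, 2)},
        {(0, 0), (0, 2), (1, 3), (4, 1)},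
        {(0, 0), (0, 3), (2, 0), (5, 4)},
        {(0, 0), (1, 4), (4, 4), (5, 2)}} },
    { multiplier := 3, frequency := fingerprint 882 34692 176106,
      family := {{(0, 0), (0, 1), (1, 0), (2, 2)},
        {(0, 0), (0, 2), (1, 3), (4, 1)},
        {(0, 0), (0, 3), (2, 6), (5, 3)},
        {(0, 0), (1, 4), (3, 2), (4, 0)}} },
    { multiplier := 1, frequency := fingerprint 1176 37632 172872,
      family := {{(0, 0), (0, 1), (1, 0), (2, 2)},
        {(0, 0), (0, 2), (1, 3), (4, 1)},
        {(0, 0), (0, 3), (2, 6), (5, 3)},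
        {(0, 0), (1, 4), (4, 4), (5, 2)}} },
    { multiplier := 1, frequency := fingerprint 2058 44100 165522,
      family := {{(0, 0), (0, 1), (1, 0), (2, 2)},
        {(0, 0), (0, 2), (1, 3), (5, 4)},
        {(0, 0), (0, 3), (3, 0), (4, 5)},
        {(0, 0), (1, 4), (3, 1), (5, 1)}} },
    { multiplier := 1, frequency := fingerprint 882 37044 173754,
      family := {{(0, 0), (0, 1), (1, 0), (2, 2)},
        {(0, 0), (0, 2), (1, 3), (5, 4)},
        {(0, 0), (0, 3), (3, 0), (4, 5)},
        {(0, 0), (1, 4), (3, 3), (5, 3)}} },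
    { multiplier := 3, frequency := fingerprint 10584 76440 124656,
      family := {{(0, 0), (0, 1), (1, 0), (2, 2)},
        {(0, 0), (0, 2), (1, 3), (5, 4)},
        {(0, 0), (0, 3), (3, 5), (4, 3)},
        {(0, 0), (1, 4), (3, 3), (5, 3)}} },
    { multiplier := 3, frequency := fingerprint 6174 55860 149646,
      family := {{(0, 0), (0, 1), (1, 0), (2, 2)},
        {(0, 0), (0, 2), (1, 5), (4, 4)},
        {(0, 0), (0, 3), (2, 6), (4, 3)},
        {(0, 0), (1, 1), (3, 1), (6, 3)}} },
    { multiplier := 1, frequency := fingerprint 5292 48216 158172,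
      family := {{(0, 0), (0, 1), (1, 0), (2, 2)},
        {(0, 0), (0, 2), (1, 5), (5, 2)},
        {(0, 0), (0, 3), (3, 2), (4, 6)},
        {(0, 0), (1, 1), (3, 0), (5, 3)}} },
    { multiplier := 1, frequency := fingerprint 2352 42336 166992,
      family := {{(0, 0), (0, 1), (1, 0), (2, 2)},
        {(0, 0), (0, 2), (1, 5), (5, 2)},
        {(0, 0), (0, 3), (3, 4), (4, 1)},
        {(0, 0), (1, 1), (3, 5), (5, 1)}} }]

/-!
A difference family `F` with blocks of size `4` in `ℤ₇ × ℤ₇` is determined up to translation of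
its blocks by its development. Since `4` and `7` are coprime, no block is fixed by a nonzero
translation, so that the development is a Steiner system closed under translation
(`IsDifferenceFamily.isInvariantSteiner`). In such a system two blocks that share a difference are
translates of each other (`IsInvariantSteiner.eq_translate`), and the blocks through the origin
determine all lines.

*The listed families.* Points are coded by numbers below `49`. The lines through the origin are
packed into one number, the line table, and `tableCheck_listed` verifies that every nonzero element
is a difference of some base block. Four blocks have only `48` differences, so each element occurs
once (`isDifferenceFamily_codeFamily`). The multiplier counts the pairs of images of `(1, 0)` and
`(0, 1)` with nonzero determinant that map base blocks to blocks (`multiplierNumber_eq`). By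
translation invariance the fingerprint is `49` times the contribution of the quadruples with `o = 0`.
The lines `po` and `py` always meet `ox`, so only two points `u` have to be examined, and the
frequencies beyond `2` vanish. The three remaining frequencies are computed as the digits of one
number (`histogram_eq`). Isomorphic systems have the same fingerprint, and the twelve fingerprints
differ, which gives non-isomorphism, and with it multiplier-inequivalence.

*Completeness.* In a translation-invariant system the `12` differences of a block are distinct, and
blocks in different translation classes have disjoint sets of differences. The block through `0` and
`(0, 1)` can therefore be listed, and up to an affine map it is `0, (0, 1), (1, 0), p` for one of
four points `p` (`expand_root`). From there, a search picks an unused difference `d`, runs through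
all blocks `0, d, c, e` with unused differences, and after three steps has exhausted all
differences. For every collection that it reaches, an automorphism maps the collection into the
development of a listed family (`search_rootPoints`). Every block of the system is a translate of a
block of the collection, so the automorphism maps the whole system into that development
(`IsInvariantSteiner.exists_listed`), and a Steiner system contained in another one with the same
parameters is equal to it. The finite checks are evaluated in the kernel on natural number
arithmetic.
-/

/-! ### Translation-invariant Steiner systems -/

/-- The group `ℤ₇ × ℤ₇`. -/
abbrev Plane := ZMod 7 × ZMod 7

theorem mem_translateBlock {G : Type*} [AddCommGroup G] [DecidableEq G] {B : Finset G} {g x : G} :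
    x ∈ translateBlock B g ↔ x - g ∈ B := by
  simp only [translateBlock, mem_image]
  constructor
  · rintro ⟨b, hb, rfl⟩
    simpa using hb
  · intro h
    exact ⟨x - g, h, by simp⟩

theorem card_translateBlock {G : Type*} [AddCommGroup G] [DecidableEq G] (B : Finset G) (g : G) :
    #(translateBlock B g) = #B :=
  card_image_of_injective _ (add_left_injective g)

theorem mem_development {G : Type*} [AddCommGroup G] [Fintype G] [DecidableEq G]
    {F : Finset (Finset G)} {C : Finset G} :
    C ∈ development F ↔ ∃ B ∈ F, ∃ g, translateBlock B g = C := by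
  simp [development]

theorem mem_mapBlocks {X Y : Type*} [DecidableEq Y] {f : X → Y} {F : Finset (Finset X)}
    {C : Finset Y} : C ∈ mapBlocks f F ↔ ∃ B ∈ F, B.image f = C := by
  simp [mapBlocks]

theorem translateBlock_image {G : Type*} [AddCommGroup G] [DecidableEq G] (α : G ≃+ G)
    (B : Finset G) (g : G) :
    (translateBlock B g).image α = translateBlock (B.image α) (α g) := by
  simp only [translateBlock, image_image]
  congr 1
  ext b
  simp

theorem development_mapBlocks {G : Type*} [AddCommGroup G] [Fintype G] [DecidableEq G]
    (α : G ≃+ G) (F : Finset (Finset G)) :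
    development (mapBlocks α F) = mapBlocks α (development F) := by
  ext C
  simp only [mem_development, mem_mapBlocks]
  constructor
  · rintro ⟨_, ⟨B, hB, rfl⟩, g, rfl⟩
    refine ⟨_, ⟨B, hB, α.symm g, rfl⟩, ?_⟩
    rw [translateBlock_image, α.apply_symm_apply]
  · rintro ⟨_, ⟨B, hB, g, rfl⟩, rfl⟩
    exact ⟨_, ⟨B, hB, rfl⟩, α g, (translateBlock_image α B g).symm⟩

/-- Translation by `g` changes the sum of the points of a `4`-subset by `4 g`, which vanishes only
for `g = 0`. Hence the divisor in `partialDiffCount` is `1` for such blocks. -/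
theorem eq_zero_of_translateBlock_eq {B : Finset Plane} (hB : #B = 4) {g : Plane}
    (h : translateBlock B g = B) : g = 0 := by
  have h1 : ∑ b ∈ translateBlock B g, b = ∑ b ∈ B, (b + g) :=
    sum_image fun _ _ _ _ hab => add_left_injective g hab
  rw [h, sum_add_distrib, sum_const, hB, left_eq_add] at h1
  have h4 : ∀ g : Plane, 4 • g = 0 → g = 0 := by decide
  exact h4 g h1

theorem partialDiffCount_eq {B : Finset Plane} (hB : #B = 4) (d : Plane) :
    partialDiffCount B d = #{q ∈ B ×ˢ B | q.1 - q.2 = d} := by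
  have : ({g : Plane | translateBlock B g = B} : Finset Plane) = {0} := by
    ext g
    simp only [mem_filter, mem_univ, true_and, mem_singleton]
    refine ⟨eq_zero_of_translateBlock_eq hB, ?_⟩
    rintro rfl
    simp [translateBlock]
  rw [partialDiffCount, this, card_singleton, Nat.div_one]

/-- A Steiner system `S(2, 4, 49)` on `ℤ₇ × ℤ₇` whose block set is closed under translation. -/
structure IsInvariantSteiner (𝓑 : Finset (Finset Plane)) : Prop where
  steiner : IsSteinerSystem 49 4 𝓑
  translate_mem : ∀ B ∈ 𝓑, ∀ g, translateBlock B g ∈ 𝓑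

theorem IsSteinerSystem.eq_of_mem {X : Type*} [Fintype X] {v k : ℕ} {𝓑 : Finset (Finset X)}
    (h : IsSteinerSystem v k 𝓑) {B C : Finset X} (hB : B ∈ 𝓑) (hC : C ∈ 𝓑) {x y : X}
    (hxy : x ≠ y) (hxB : x ∈ B) (hyB : y ∈ B) (hxC : x ∈ C) (hyC : y ∈ C) : B = C :=
  (h.2.2 x y hxy).unique ⟨hB, hxB, hyB⟩ ⟨hC, hxC, hyC⟩

theorem IsSteinerSystem.eq_of_subset {X : Type*} [Fintype X] {v k : ℕ} (hk : 1 < k)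
    {𝓑 𝓒 : Finset (Finset X)} (hB : IsSteinerSystem v k 𝓑) (hC : IsSteinerSystem v k 𝓒)
    (h : 𝓑 ⊆ 𝓒) : 𝓑 = 𝓒 := by
  refine h.antisymm fun C hCm => ?_
  obtain ⟨x, hx, y, hy, hxy⟩ := one_lt_card.1 (hk.trans_eq (hC.2.1 C hCm).symm)
  obtain ⟨B, ⟨hBm, hxB, hyB⟩, -⟩ := hB.2.2 x y hxy
  rwa [← hC.eq_of_mem (h hBm) hCm hxy hxB hyB hx hy]

theorem IsSteinerSystem.mapBlocks {X Y : Type*} [Fintype X] [Fintype Y] [DecidableEq Y] {v k : ℕ}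
    {𝓑 : Finset (Finset X)} (h : IsSteinerSystem v k 𝓑) (e : X ≃ Y) :
    IsSteinerSystem v k (mapBlocks e 𝓑) := by
  refine ⟨by rw [← Fintype.card_congr e, h.1], fun C hC => ?_, fun x y hxy => ?_⟩
  · obtain ⟨B, hB, rfl⟩ := mem_mapBlocks.1 hC
    rw [card_image_of_injective _ e.injective, h.2.1 B hB]
  · obtain ⟨B, ⟨hB, hx, hy⟩, huniq⟩ :=
      h.2.2 (e.symm x) (e.symm y) fun h => hxy (e.symm.injective h)
    refine ⟨B.image e, ⟨mem_mapBlocks.2 ⟨B, hB, rfl⟩, ?_, ?_⟩, ?_⟩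
    · exact mem_image.2 ⟨_, hx, e.apply_symm_apply x⟩
    · exact mem_image.2 ⟨_, hy, e.apply_symm_apply y⟩
    · rintro _ ⟨hC, hxC, hyC⟩
      obtain ⟨C, hCm, rfl⟩ := mem_mapBlocks.1 hC
      obtain ⟨x', hx', rfl⟩ := mem_image.1 hxC
      obtain ⟨y', hy', rfl⟩ := mem_image.1 hyC
      rw [huniq C ⟨hCm, by simpa using hx', by simpa using hy'⟩]

namespace IsInvariantSteiner

variable {𝓑 : Finset (Finset Plane)}

/-- In a translation-invariant Steiner system, blocks that share a difference are translates. -/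
theorem eq_translate (h : IsInvariantSteiner 𝓑) {B C : Finset Plane} (hB : B ∈ 𝓑) (hC : C ∈ 𝓑)
    {p q p' q' : Plane} (hp : p ∈ B) (hq : q ∈ B) (hp' : p' ∈ C) (hq' : q' ∈ C) (hpq : p ≠ q)
    (hd : q - p = q' - p') : B = translateBlock C (p - p') := by
  refine h.steiner.eq_of_mem hB (h.translate_mem C hC _) hpq hp hq
    (mem_translateBlock.2 (by simpa using hp')) (mem_translateBlock.2 ?_)
  have : q - (p - p') = q' := by rw [← sub_add, hd, sub_add_cancel]
  rwa [this]

theorem left_eq_of_sub_eq (h : IsInvariantSteiner 𝓑) {B : Finset Plane} (hB : B ∈ 𝓑)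
    {p q p' q' : Plane} (hp : p ∈ B) (hq : q ∈ B) (hp' : p' ∈ B) (hq' : q' ∈ B) (hpq : p ≠ q)
    (hd : q - p = q' - p') : p = p' :=
  sub_eq_zero.1 <| eq_zero_of_translateBlock_eq (h.steiner.2.1 B hB)
    (h.eq_translate hB hB hp hq hp' hq' hpq hd).symm

theorem mapBlocks (h : IsInvariantSteiner 𝓑) (α : Plane ≃+ Plane) :
    IsInvariantSteiner (mapBlocks α 𝓑) := by
  refine ⟨h.steiner.mapBlocks α.toEquiv, fun C hC g => ?_⟩
  obtain ⟨B, hB, rfl⟩ := mem_mapBlocks.1 hC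
  refine mem_mapBlocks.2 ⟨_, h.translate_mem B hB (α.symm g), ?_⟩
  rw [translateBlock_image, α.apply_symm_apply]

end IsInvariantSteiner

theorem IsDifferenceFamily.isInvariantSteiner {F : Finset (Finset Plane)}
    (h : IsDifferenceFamily 49 4 F) : IsInvariantSteiner (development F) := by
  obtain ⟨hcard, h4, hd⟩ := h
  refine ⟨⟨hcard, fun C hC => ?_, fun x y hxy => ?_⟩, fun C hC g => ?_⟩
  · obtain ⟨B, hB, g, rfl⟩ := mem_development.1 hC
    rw [card_translateBlock, h4 B hB]
  · have h1 := hd (x - y) (sub_ne_zero.2 hxy)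
    rw [sum_congr rfl fun B hB => partialDiffCount_eq (h4 B hB) _, ← card_sigma,
      card_eq_one] at h1
    obtain ⟨⟨B, b, b'⟩, hS⟩ := h1
    have hmem : ∀ C (c c' : Plane), C ∈ F → c ∈ C → c' ∈ C → c - c' = x - y →
        C = B ∧ c = b := by
      intro C c c' hC hc hc' hcc
      have : (⟨C, c, c'⟩ : Σ _ : Finset Plane, Plane × Plane) ∈
          F.sigma fun B => {q ∈ B ×ˢ B | q.1 - q.2 = x - y} := by simp [hC, hc, hc', hcc]
      rw [hS, mem_singleton] at this
      simp only [Sigma.mk.injEq, heq_eq_eq, Prod.mk.injEq] at this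
      exact ⟨this.1, this.2.1⟩
    have hB : (⟨B, b, b'⟩ : Σ _ : Finset Plane, Plane × Plane) ∈
        F.sigma fun B => {q ∈ B ×ˢ B | q.1 - q.2 = x - y} := by rw [hS]; simp
    simp only [mem_sigma, mem_filter, mem_product] at hB
    obtain ⟨hBF, ⟨hb, hb'⟩, hbb⟩ := hB
    refine ⟨translateBlock B (x - b), ⟨mem_development.2 ⟨B, hBF, _, rfl⟩,
      mem_translateBlock.2 (by simpa using hb), mem_translateBlock.2 ?_⟩, ?_⟩
    · have : y - (x - b) = b' := by
        rw [← sub_eq_zero, show y - (x - b) - b' = (b - b') - (x - y) by abel, hbb, sub_self]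
      rwa [this]
    · rintro _ ⟨hC, hx, hy⟩
      obtain ⟨C, hCF, g, rfl⟩ := mem_development.1 hC
      obtain ⟨rfl, hg⟩ := hmem C _ _ hCF (mem_translateBlock.1 hx) (mem_translateBlock.1 hy)
        (by abel)
      rw [← hg, sub_sub_cancel]
  · obtain ⟨B, hB, g', rfl⟩ := mem_development.1 hC
    refine mem_development.2 ⟨B, hB, g' + g, ?_⟩
    ext x
    simp only [mem_translateBlock]
    rw [sub_sub, add_comm]

/-! ### Invariance of the fingerprint -/

section Fingerprint

theorem blockCollinear_mapBlocks {X Y : Type*} [DecidableEq Y] {𝓑 : Finset (Finset X)}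
    (e : X ≃ Y) (a b c : X) :
    BlockCollinear (mapBlocks e 𝓑) (e a) (e b) (e c) ↔ BlockCollinear 𝓑 a b c := by
  simp [BlockCollinear, mapBlocks]

variable {X Y : Type*} [DecidableEq X] [DecidableEq Y] {𝓑 : Finset (Finset X)}
variable [Fintype X] [Fintype Y]

theorem blockLine_mapBlocks (e : X ≃ Y) (a b : X) :
    blockLine (mapBlocks e 𝓑) (e a) (e b) = (blockLine 𝓑 a b).image e := by
  ext c
  obtain ⟨c, rfl⟩ := e.surjective c
  simp [blockLine, blockCollinear_mapBlocks]

theorem nonMeetingCount_mapBlocks (e : X ≃ Y) (o x y p : X) :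
    nonMeetingCount (mapBlocks e 𝓑) (e o) (e x) (e y) (e p) = nonMeetingCount 𝓑 o x y p := by
  rw [nonMeetingCount, nonMeetingCount, blockLine_mapBlocks, blockLine_mapBlocks, filter_image,
    card_image_of_injective _ e.injective]
  simp only [blockLine_mapBlocks, disjoint_image e.injective]

/-- The number of triples `(x, y, p)` that contribute to `hyperbolicFrequency 𝓑 n` together with
the point `o`. -/
def pointFrequency (𝓑 : Finset (Finset X)) (o : X) (n : ℕ) : ℕ :=
  #{t : X × X × X | ¬ BlockCollinear 𝓑 o t.1 t.2.1 ∧ t.2.2 ∈ blockLine 𝓑 t.1 t.2.1 ∧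
    t.2.2 ≠ t.1 ∧ t.2.2 ≠ t.2.1 ∧ nonMeetingCount 𝓑 o t.1 t.2.1 t.2.2 = n}

theorem hyperbolicFrequency_eq_sum (n : ℕ) :
    hyperbolicFrequency 𝓑 n = ∑ o, pointFrequency 𝓑 o n := by
  rw [hyperbolicFrequency, card_filter, Fintype.sum_prod_type]
  simp only [pointFrequency, card_filter]

theorem pointFrequency_mapBlocks (e : X ≃ Y) (o : X) (n : ℕ) :
    pointFrequency (mapBlocks e 𝓑) (e o) n = pointFrequency 𝓑 o n := by
  symm
  refine card_equiv (e.prodCongr (e.prodCongr e)) fun t => ?_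
  simp [blockCollinear_mapBlocks, blockLine_mapBlocks, nonMeetingCount_mapBlocks]

theorem hyperbolicFrequency_mapBlocks (e : X ≃ Y) (n : ℕ) :
    hyperbolicFrequency (mapBlocks e 𝓑) n = hyperbolicFrequency 𝓑 n := by
  rw [hyperbolicFrequency_eq_sum, hyperbolicFrequency_eq_sum, ← e.sum_comp]
  simp only [pointFrequency_mapBlocks]

end Fingerprint

theorem IsInvariantSteiner.hyperbolicFrequency_eq {𝓑 : Finset (Finset Plane)}
    (h : IsInvariantSteiner 𝓑) (n : ℕ) :
    hyperbolicFrequency 𝓑 n = 49 * pointFrequency 𝓑 0 n := by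
  have key : ∀ o, pointFrequency 𝓑 o n = pointFrequency 𝓑 0 n := by
    intro o
    have hmap : _root_.mapBlocks (Equiv.addRight o) 𝓑 = 𝓑 := by
      ext C
      rw [mem_mapBlocks]
      constructor
      · rintro ⟨B, hB, rfl⟩
        exact h.translate_mem B hB o
      · intro hC
        refine ⟨_, h.translate_mem C hC (-o), ?_⟩
        ext x
        simp [translateBlock]
    have := pointFrequency_mapBlocks (𝓑 := 𝓑) (Equiv.addRight o) 0 n
    rwa [hmap, Equiv.coe_addRight, show (fun x => x + o) 0 = o from zero_add o] at this
  rw [hyperbolicFrequency_eq_sum, sum_congr rfl fun o _ => key o, sum_const, card_univ,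
    h.steiner.1, smul_eq_mul]

/-! ### Codes of points -/

/-- Evaluates `n` before it is passed to `f`: the kernel reduces the major premise of the recursor
to a literal, so that `n` is not recomputed at each of its occurrences. -/
def force {α : Type} (n : ℕ) (f : ℕ → α) : α := Nat.rec (f 0) (fun m _ => f (Nat.succ m)) n

@[simp] theorem force_eq {α : Type} (n : ℕ) (f : ℕ → α) : force n f = f n := by
  cases n <;> rfl

/-- The point `(x, y)` with code `7 x + y`. -/
def pt (n : ℕ) : Plane := ((n / 7 : ℕ), (n : ℕ))

/-- The code `7 x + y` of the point `(x, y)`. -/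
def code (p : Plane) : ℕ := 7 * p.1.val + p.2.val

theorem code_lt (p : Plane) : code p < 49 := by
  have h1 := ZMod.val_lt p.1
  have h2 := ZMod.val_lt p.2
  unfold code
  omega

theorem code_pt {n : ℕ} (hn : n < 49) : code (pt n) = n := by
  simp only [code, pt, ZMod.val_natCast]
  omega

@[simp] theorem pt_code (p : Plane) : pt (code p) = p := by
  have h1 := ZMod.val_lt p.1
  have h2 := ZMod.val_lt p.2
  have h3 : (7 * p.1.val + p.2.val) / 7 = p.1.val := by omega
  refine Prod.ext ?_ ?_
  · simp only [pt, code, h3, ZMod.natCast_val, ZMod.cast_id', id_eq]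
  · have h7 : (7 : ZMod 7) = 0 := rfl
    simp [pt, code, h7]

@[simp] theorem pt_zero : pt 0 = 0 := by simp [pt]

theorem pt_inj {m n : ℕ} (hm : m < 49) (hn : n < 49) : pt m = pt n ↔ m = n :=
  ⟨fun h => by rw [← code_pt hm, h, code_pt hn], fun h => by rw [h]⟩

theorem pt_ne_zero {n : ℕ} (hn : n < 49) (h : n ≠ 0) : pt n ≠ 0 := fun h0 =>
  h ((pt_inj hn (by norm_num)).1 (h0.trans pt_zero.symm))

theorem pt_of_lt (a b : ℕ) (hb : b < 7) : pt (7 * a + b) = ((a : ZMod 7), (b : ZMod 7)) := by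
  have h3 : (7 * a + b) / 7 = a := by omega
  have h7 : (7 : ZMod 7) = 0 := rfl
  simp [pt, h3, h7]

theorem natCast_mod_seven (n : ℕ) : ((n % 7 : ℕ) : ZMod 7) = n := ZMod.natCast_mod n 7

theorem sum_plane_eq {M : Type*} [AddCommMonoid M] (f : Plane → M) :
    ∑ p, f p = ∑ n ∈ range 49, f (pt n) := by
  refine sum_nbij' code pt (fun p _ => mem_range.2 (code_lt p)) (fun _ _ => mem_univ _)
    (fun p _ => pt_code p) (fun n hn => code_pt (mem_range.1 hn)) (fun p _ => by rw [pt_code])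

/-- Subtraction of points on codes. Here and below, operations on codes are written with the
functions of `Nat` that the kernel evaluates on literals. -/
def subC (a b : ℕ) : ℕ :=
  Nat.add (Nat.mul 7 (Nat.mod (Nat.sub (Nat.add (Nat.div a 7) 7) (Nat.div b 7)) 7))
    (Nat.mod (Nat.sub (Nat.add (Nat.mod a 7) 7) (Nat.mod b 7)) 7)

theorem subC_eq (a b : ℕ) :
    subC a b = 7 * ((a / 7 + 7 - b / 7) % 7) + (a % 7 + 7 - b % 7) % 7 := rfl

theorem subC_lt (a b : ℕ) : subC a b < 49 := by rw [subC_eq]; omega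

theorem pt_subC (a : ℕ) {b : ℕ} (hb : b < 49) : pt (subC a b) = pt a - pt b := by
  have h7 : (7 : ZMod 7) = 0 := rfl
  rw [subC_eq, pt_of_lt _ _ (Nat.mod_lt _ (by norm_num)), natCast_mod_seven, natCast_mod_seven,
    Nat.cast_sub (by omega), Nat.cast_sub (by omega)]
  simp [pt, h7]

/-- Addition of points on codes. -/
def addC (a b : ℕ) : ℕ :=
  Nat.add (Nat.mul 7 (Nat.mod (Nat.add (Nat.div a 7) (Nat.div b 7)) 7))
    (Nat.mod (Nat.add (Nat.mod a 7) (Nat.mod b 7)) 7)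

theorem addC_eq (a b : ℕ) : addC a b = 7 * ((a / 7 + b / 7) % 7) + (a % 7 + b % 7) % 7 := rfl

theorem addC_lt (a b : ℕ) : addC a b < 49 := by rw [addC_eq]; omega

theorem pt_addC (a b : ℕ) : pt (addC a b) = pt a + pt b := by
  rw [addC_eq, pt_of_lt _ _ (Nat.mod_lt _ (by norm_num)), natCast_mod_seven, natCast_mod_seven]
  simp [pt]

/-! ### Automorphisms of the plane -/

/-- The endomorphism that sends `(1, 0)` to `U` and `(0, 1)` to `V`. -/
def matHom (U V : Plane) : Plane →+ Plane where
  toFun z := (z.1 * U.1 + z.2 * V.1, z.1 * U.2 + z.2 * V.2)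
  map_zero' := by simp
  map_add' z w := by ext <;> simp <;> ring

theorem matHom_apply (U V z : Plane) :
    matHom U V z = (z.1 * U.1 + z.2 * V.1, z.1 * U.2 + z.2 * V.2) := rfl

/-- The determinant of `matHom U V`. -/
def matDet (U V : Plane) : ZMod 7 := U.1 * V.2 - U.2 * V.1

theorem matHom_injective {U V : Plane} (h : matDet U V ≠ 0) : Function.Injective (matHom U V) := by
  have : Fact (Nat.Prime 7) := ⟨by norm_num⟩
  rw [injective_iff_map_eq_zero]
  intro z hz
  rw [matHom_apply, Prod.mk_eq_zero] at hz
  obtain ⟨h1, h2⟩ := hz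
  have e1 : z.1 * matDet U V = 0 := by unfold matDet; linear_combination V.2 * h1 - V.1 * h2
  have e2 : z.2 * matDet U V = 0 := by unfold matDet; linear_combination U.1 * h2 - U.2 * h1
  exact Prod.ext ((mul_eq_zero.1 e1).resolve_right h) ((mul_eq_zero.1 e2).resolve_right h)

/-- The automorphism that sends `(1, 0)` to `U` and `(0, 1)` to `V`. -/
noncomputable def matAut (U V : Plane) (h : matDet U V ≠ 0) : Plane ≃+ Plane :=
  AddEquiv.ofBijective (matHom U V) (Finite.injective_iff_bijective.1 (matHom_injective h))

@[simp] theorem matAut_apply (U V : Plane) (h : matDet U V ≠ 0) (z : Plane) :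
    matAut U V h z = matHom U V z := rfl

theorem hom_eq_matHom (f : Plane →+ Plane) : f = matHom (f (1, 0)) (f (0, 1)) := by
  ext z : 1
  have hz : z = z.1.val • ((1, 0) : Plane) + z.2.val • ((0, 1) : Plane) := by ext <;> simp
  conv_lhs => rw [hz]
  rw [map_add, map_nsmul, map_nsmul, matHom_apply]
  ext <;> simp

theorem matDet_ne_zero (α : Plane ≃+ Plane) : matDet (α (1, 0)) (α (0, 1)) ≠ 0 := by
  intro h
  have hα : ∀ z, α z = matHom (α (1, 0)) (α (0, 1)) z := fun z =>
    DFunLike.congr_fun (hom_eq_matHom α.toAddMonoidHom) z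
  generalize α (1, 0) = U at *
  generalize α (0, 1) = V at *
  have key : ∀ z : Plane, matHom U V z = 0 → z = 0 := fun z hz => by
    rw [← hα] at hz
    simpa using hz
  unfold matDet at h
  have h1 := key (V.2, -U.2) (by
    rw [matHom_apply]; ext <;> simp only [Prod.fst_zero, Prod.snd_zero]
    · linear_combination h
    · ring)
  have h2 := key (V.1, -U.1) (by
    rw [matHom_apply]; ext <;> simp only [Prod.fst_zero, Prod.snd_zero]
    · ring
    · linear_combination -h)
  simp only [Prod.mk_eq_zero, neg_eq_zero] at h1 h2
  have h3 := key (1, 0) (by rw [matHom_apply]; simp [h1, h2])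
  exact absurd (congrArg Prod.fst h3) (by decide)

/-- Automorphisms of the plane correspond to pairs of vectors with nonzero determinant. -/
noncomputable def autEquiv :
    (Plane ≃+ Plane) ≃ {w : Plane × Plane // matDet w.1 w.2 ≠ 0} where
  toFun α := ⟨(α (1, 0), α (0, 1)), matDet_ne_zero α⟩
  invFun w := matAut w.1.1 w.1.2 w.2
  left_inv α := AddEquiv.ext fun z =>
    (DFunLike.congr_fun (hom_eq_matHom α.toAddMonoidHom) z).symm
  right_inv w := by
    ext <;> simp [matHom_apply]

/-- The code of the image of the point with code `n` under the endomorphism that sends `(1, 0)`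
and `(0, 1)` to the points with codes `u` and `v`. -/
def app (u v n : ℕ) : ℕ :=
  Nat.add
    (Nat.mul 7 (Nat.mod (Nat.add (Nat.mul (Nat.div n 7) (Nat.div u 7))
      (Nat.mul (Nat.mod n 7) (Nat.div v 7))) 7))
    (Nat.mod (Nat.add (Nat.mul (Nat.div n 7) u) (Nat.mul (Nat.mod n 7) v)) 7)

theorem app_eq (u v n : ℕ) :
    app u v n = 7 * ((n / 7 * (u / 7) + n % 7 * (v / 7)) % 7) + (n / 7 * u + n % 7 * v) % 7 := rfl

theorem app_lt (u v n : ℕ) : app u v n < 49 := by rw [app_eq]; omega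

theorem pt_app (u v n : ℕ) : pt (app u v n) = matHom (pt u) (pt v) (pt n) := by
  rw [app_eq, pt_of_lt _ _ (Nat.mod_lt _ (by norm_num)), natCast_mod_seven, natCast_mod_seven]
  simp [pt, matHom_apply]

/-- Tests whether the points with codes `u` and `v` are linearly dependent. -/
def dependent (u v : ℕ) : Bool :=
  Nat.beq (Nat.mod (Nat.mul (Nat.div u 7) v) 7) (Nat.mod (Nat.mul u (Nat.div v 7)) 7)

theorem dependent_eq_false (u v : ℕ) :
    dependent u v = false ↔ matDet (pt u) (pt v) ≠ 0 := by
  rw [← not_iff_not, Bool.not_eq_false, not_not]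
  have : dependent u v = true ↔ (u / 7 * v) % 7 = (u * (v / 7)) % 7 :=
    iff_of_eq Nat.beq_eq
  rw [this]
  change _ ≡ _ [MOD 7] ↔ _
  rw [← ZMod.natCast_eq_natCast_iff, matDet, sub_eq_zero]
  simp [pt]

/-! ### Bounded sums and blocks on codes -/

/-- The sum of `f m` over `m < n`, in a form that the kernel evaluates quickly. -/
def sumBelow (n : ℕ) (f : ℕ → ℕ) : ℕ := Nat.rec 0 (fun m r => Nat.add r (f m)) n

theorem sumBelow_eq (n : ℕ) (f : ℕ → ℕ) : sumBelow n f = ∑ m ∈ range n, f m := by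
  induction n with
  | zero => rfl
  | succ n ih => rw [sum_range_succ, ← ih]; rfl

/-- The block that consists of the origin and the three points with the given codes. -/
def blk (t : ℕ × ℕ × ℕ) : Finset Plane := {0, pt t.1, pt t.2.1, pt t.2.2}

theorem mem_blk {b c e : ℕ} {x : Plane} :
    x ∈ blk (b, c, e) ↔ x = 0 ∨ x = pt b ∨ x = pt c ∨ x = pt e := by simp [blk]

theorem card_blk_le (t : ℕ × ℕ × ℕ) : #(blk t) ≤ 4 := card_le_four

theorem card_four_iff {α : Type*} [DecidableEq α] {a b c d : α} :
    #({a, b, c, d} : Finset α) = 4 ↔ a ≠ b ∧ a ≠ c ∧ a ≠ d ∧ b ≠ c ∧ b ≠ d ∧ c ≠ d := by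
  have h' := Multiset.toFinset_card_eq_card_iff_nodup (m := ([a, b, c, d] : Multiset α))
  have e : (([a, b, c, d] : Multiset α)).toFinset = {a, b, c, d} := by ext; simp
  rw [e] at h'
  rw [show (4 : ℕ) = Multiset.card ([a, b, c, d] : Multiset α) from rfl, h']
  simp
  tauto

theorem card_blk {b c e : ℕ} : #(blk (b, c, e)) = 4 ↔
    pt b ≠ 0 ∧ pt c ≠ 0 ∧ pt e ≠ 0 ∧ pt b ≠ pt c ∧ pt b ≠ pt e ∧ pt c ≠ pt e := by
  unfold blk
  rw [card_four_iff]
  simp only [ne_comm (a := (0 : Plane))]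

/-- In a block of size `4` through the origin, the other points can be named by codes, starting
from any of them. -/
theorem exists_blk_eq {B : Finset Plane} (hB : #B = 4) (h0 : 0 ∈ B) {d : ℕ} (hd : pt d ∈ B)
    (hd0 : pt d ≠ 0) : ∃ c e, c < 49 ∧ e < 49 ∧ c ≠ e ∧ B = blk (d, c, e) := by
  have h2 : #((B.erase 0).erase (pt d)) = 2 := by
    rw [card_erase_of_mem (mem_erase.2 ⟨hd0, hd⟩), card_erase_of_mem h0, hB]
  obtain ⟨x, y, hxy, h⟩ := card_eq_two.1 h2
  refine ⟨code x, code y, code_lt x, code_lt y, fun h => hxy ?_, ?_⟩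
  · rw [← pt_code x, h, pt_code]
  · rw [← insert_erase h0, ← insert_erase (mem_erase.2 ⟨hd0, hd⟩), h]
    simp [blk]

/-! ### Line tables -/

/-- The third point on the line through the origin and `d`, read from a line table. This is a
natural number whose binary digits `12 d, …, 12 d + 11` hold, six digits each, the codes of the two
remaining points of the line through the origin and the point with code `d`. -/
def third (T d : ℕ) : ℕ := Nat.land (Nat.shiftRight T (Nat.mul 12 d)) 63

/-- The fourth point on the line through the origin and `d`. -/
def fourth (T d : ℕ) : ℕ := Nat.land (Nat.shiftRight T (Nat.add (Nat.mul 12 d) 6)) 63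

/-- The number `T` lists the lines through the origin of the block system `𝓑`. -/
def IsLineTable (T : ℕ) (𝓑 : Finset (Finset Plane)) : Prop :=
  ∀ d < 49, d ≠ 0 → third T d < 49 ∧ fourth T d < 49 ∧ blk (d, third T d, fourth T d) ∈ 𝓑

/-- Tests whether `z` is one of `r`, `s`. -/
def oneOf (r s z : ℕ) : Bool := cond (Nat.beq z r) true (Nat.beq z s)

theorem oneOf_eq (r s z : ℕ) : oneOf r s z = true ↔ z = r ∨ z = s := by
  have h : ∀ a b : ℕ, a.beq b = true ↔ a = b := fun a b => iff_of_eq Nat.beq_eq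
  unfold oneOf
  rcases hz : z.beq r with _ | _
  · have : z ≠ r := fun h' => by rw [(h z r).2 h'] at hz; exact absurd hz (by decide)
    simp [h, this]
  · simp [(h z r).1 hz]

/-- Tests whether the endomorphism given by `u` and `v` maps `blk t` to a block of the system
with line table `T`. -/
def mapsInto (T u v : ℕ) (t : ℕ × ℕ × ℕ) : Bool :=
  force (app u v t.1) fun b => force (third T b) fun r => force (fourth T b) fun s =>
    cond (oneOf r s (app u v t.2.1)) (oneOf r s (app u v t.2.2)) false

theorem mapsInto_iff {T : ℕ} {𝓑 : Finset (Finset Plane)} (hT : IsLineTable T 𝓑)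
    (h𝓑 : IsSteinerSystem 49 4 𝓑) {u v : ℕ} (huv : matDet (pt u) (pt v) ≠ 0) {t : ℕ × ℕ × ℕ}
    (ht : #(blk t) = 4) :
    mapsInto T u v t = true ↔ (blk t).image (matAut (pt u) (pt v) huv) ∈ 𝓑 := by
  obtain ⟨b, c, e⟩ := t
  have himg : (blk (b, c, e)).image (matAut (pt u) (pt v) huv) =
      blk (app u v b, app u v c, app u v e) := by
    simp [blk, image_insert, pt_app]
  have hcard : #(blk (app u v b, app u v c, app u v e)) = 4 := by
    rw [← himg, card_image_of_injective _ (AddEquiv.injective _), ht]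
  have hne := card_blk.1 hcard
  have hb0 : app u v b ≠ 0 := fun h => hne.1 (by rw [h, pt_zero])
  obtain ⟨hr, hs, hm⟩ := hT _ (app_lt u v b) hb0
  have hiff : mapsInto T u v (b, c, e) = true ↔
      (app u v c = third T (app u v b) ∨ app u v c = fourth T (app u v b)) ∧
      (app u v e = third T (app u v b) ∨ app u v e = fourth T (app u v b)) := by
    rw [← oneOf_eq, ← oneOf_eq]
    simp only [mapsInto, force_eq]
    cases oneOf (third T (app u v b)) (fourth T (app u v b)) (app u v c) <;> simp
  rw [hiff, himg]
  constructor
  · rintro ⟨h1, h2⟩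
    have : blk (app u v b, app u v c, app u v e) =
        blk (app u v b, third T (app u v b), fourth T (app u v b)) := by
      refine eq_of_subset_of_card_le (fun x hx => ?_) ((card_blk_le _).trans hcard.ge)
      rw [mem_blk] at hx ⊢
      rcases hx with rfl | rfl | rfl | rfl
      · exact Or.inl rfl
      · exact Or.inr (Or.inl rfl)
      · rcases h1 with h | h <;> simp [h]
      · rcases h2 with h | h <;> simp [h]
    rwa [this]
  · intro h
    have heq := h𝓑.eq_of_mem h hm hne.1 (mem_blk.2 (Or.inr (Or.inl rfl))) (mem_blk.2 (Or.inl rfl))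
      (mem_blk.2 (Or.inr (Or.inl rfl))) (mem_blk.2 (Or.inl rfl))
    have aux : ∀ z, pt (app u v z) ∈ blk (app u v b, app u v c, app u v e) →
        pt (app u v z) ≠ 0 → pt (app u v z) ≠ pt (app u v b) →
        app u v z = third T (app u v b) ∨ app u v z = fourth T (app u v b) := by
      intro z hz h0 hb
      rw [heq, mem_blk] at hz
      rcases hz with h | h | h | h
      · exact absurd h h0
      · exact absurd h hb
      · exact Or.inl ((pt_inj (app_lt _ _ _) hr).1 h)
      · exact Or.inr ((pt_inj (app_lt _ _ _) hs).1 h)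
    exact ⟨aux c (mem_blk.2 (by simp)) hne.2.1 hne.2.2.2.1.symm,
      aux e (mem_blk.2 (by simp)) hne.2.2.1 hne.2.2.2.2.1.symm⟩

/-! ### The listed families on codes -/

/-- The collection of base blocks `blk t` for `t` in the list. -/
def codeFamily (L : List (ℕ × ℕ × ℕ)) : Finset (Finset Plane) := (L.map blk).toFinset

theorem mem_codeFamily {L : List (ℕ × ℕ × ℕ)} {B : Finset Plane} :
    B ∈ codeFamily L ↔ ∃ t ∈ L, blk t = B := by
  simp [codeFamily]

/-- The listed families, each base block given by the codes of its points other than the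
origin. -/
def listedCodes : Fin 12 → List (ℕ × ℕ × ℕ) :=
  ![[(1, 7, 27), (2, 17, 25), (3, 12, 40), (10, 14, 32)],
    [(1, 7, 27), (2, 17, 25), (3, 12, 40), (10, 34, 45)],
    [(1, 7, 16), (2, 10, 29), (3, 14, 39), (11, 23, 28)],
    [(1, 7, 16), (2, 10, 29), (3, 14, 39), (11, 32, 37)],
    [(1, 7, 16), (2, 10, 29), (3, 20, 38), (11, 23, 28)],
    [(1, 7, 16), (2, 10, 29), (3, 20, 38), (11, 32, 37)],
    [(1, 7, 16), (2, 10, 39), (3, 21, 33), (11, 22, 36)],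
    [(1, 7, 16), (2, 10, 39), (3, 21, 33), (11, 24, 38)],
    [(1, 7, 16), (2, 10, 39), (3, 26, 31), (11, 24, 38)],
    [(1, 7, 16), (2, 12, 32), (3, 20, 31), (8, 22, 45)],
    [(1, 7, 16), (2, 12, 37), (3, 23, 34), (8, 21, 38)],
    [(1, 7, 16), (2, 12, 37), (3, 25, 29), (8, 26, 36)]]

theorem listedFamilies_family (i : Fin 12) :
    (listedFamilies i).family = codeFamily (listedCodes i) := by
  revert i
  decide +kernel

/-- The line table entry at `x` with the points `y`, `z`. -/
def tableEntry (x y z : ℕ) : ℕ := Nat.shiftLeft (Nat.add y (Nat.mul 64 z)) (Nat.mul 12 x)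

/-- The line table entries of the block through the origin with the other points `x`, `y`, `z`. -/
def blockEntries (x y z : ℕ) : ℕ :=
  Nat.add (tableEntry x y z) (Nat.add (tableEntry y z x) (tableEntry z x y))

/-- The line table of the development of `codeFamily L`. Each base block has one translate through
the origin for each of its points. -/
def lineTable : List (ℕ × ℕ × ℕ) → ℕ
  | [] => 0
  | (b, c, e) :: L =>
    Nat.add (Nat.add (Nat.add (blockEntries b c e)
      (blockEntries (subC 0 b) (subC c b) (subC e b)))
      (Nat.add (blockEntries (subC 0 c) (subC b c) (subC e c))
      (blockEntries (subC 0 e) (subC b e) (subC c e)))) (lineTable L)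

/-- Tests whether some translate of `blk t` lies in the block with the codes `0`, `d`, `r`, `s`. -/
def hasTranslateIn (d r s : ℕ) (t : ℕ × ℕ × ℕ) : Bool :=
  [0, t.1, t.2.1, t.2.2].any fun p => [0, t.1, t.2.1, t.2.2].all fun z =>
    cond (oneOf 0 d (subC z p)) true (oneOf r s (subC z p))

/-- Tests whether `T` is a line table of the development of `codeFamily L`, where `L` has at most
four members, each of them the codes of three distinct points other than the origin. -/
def tableCheck (L : List (ℕ × ℕ × ℕ)) (T : ℕ) : Bool :=
  Nat.ble L.length 4 &&
  (L.all fun t => decide (t.1 < 49 ∧ t.2.1 < 49 ∧ t.2.2 < 49 ∧ #(blk t) = 4)) &&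
  (List.range 49).all fun d => Nat.beq d 0 || force (third T d) fun r => force (fourth T d) fun s =>
    decide (r < 49) && decide (s < 49) && L.any (hasTranslateIn d r s)

theorem tableCheck_listed (i : Fin 12) :
    force (lineTable (listedCodes i)) (tableCheck (listedCodes i)) = true := by
  revert i
  decide +kernel

/-! ### The listed families are difference families -/

theorem blk_mem_development_of_hasTranslateIn {L : List (ℕ × ℕ × ℕ)} {d r s : ℕ}
    {t : ℕ × ℕ × ℕ} (ht : t ∈ L) (hlt : t.1 < 49 ∧ t.2.1 < 49 ∧ t.2.2 < 49 ∧ #(blk t) = 4)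
    (h : hasTranslateIn d r s t = true) :
    blk (d, r, s) ∈ development (codeFamily L) := by
  obtain ⟨b, c, e⟩ := t
  obtain ⟨h1, h2, h3, h4⟩ := hlt
  obtain ⟨p, hp, hall⟩ := List.any_eq_true.1 h
  rw [List.all_eq_true] at hall
  have hp49 : p < 49 := by
    simp only [List.mem_cons, List.not_mem_nil, or_false] at hp
    rcases hp with rfl | rfl | rfl | rfl <;> first | assumption | norm_num
  refine mem_development.2 ⟨blk (b, c, e), mem_codeFamily.2 ⟨_, ht, rfl⟩, -pt p, ?_⟩
  refine eq_of_subset_of_card_le (fun x hx => ?_)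
    ((card_blk_le _).trans (by rw [card_translateBlock, h4]))
  rw [mem_translateBlock, sub_neg_eq_add] at hx
  have key : ∀ z ∈ [0, b, c, e], pt z - pt p ∈ blk (d, r, s) := by
    intro z hz
    have hz' := hall z hz
    have : subC z p = 0 ∨ subC z p = d ∨ subC z p = r ∨ subC z p = s := by
      have h01 := oneOf_eq 0 d (subC z p)
      have hrs := oneOf_eq r s (subC z p)
      cases h0 : oneOf 0 d (subC z p)
      · rw [h0] at hz'
        have := hrs.1 hz'
        tauto
      · have := h01.1 h0
        tauto
    rw [← pt_subC z hp49, mem_blk]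
    rcases this with h | h | h | h <;> rw [h] <;> simp
  have hx' : x = (x + pt p) - pt p := by abel
  rw [hx']
  rcases mem_blk.1 hx with h | h | h | h <;> rw [h]
  · rw [← pt_zero]; exact key 0 (by simp)
  · exact key b (by simp)
  · exact key c (by simp)
  · exact key e (by simp)

theorem tableCheck_spec {L : List (ℕ × ℕ × ℕ)} {T : ℕ} (h : tableCheck L T = true) :
    L.length ≤ 4 ∧ (∀ t ∈ L, #(blk t) = 4) ∧ IsLineTable T (development (codeFamily L)) := by
  simp only [tableCheck, Bool.and_eq_true, List.all_eq_true, decide_eq_true_eq] at h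
  obtain ⟨⟨hlen, hL⟩, hT⟩ := h
  refine ⟨Nat.le_of_ble_eq_true hlen, fun t ht => (hL t ht).2.2.2, fun d hd hd0 => ?_⟩
  have h := hT d (List.mem_range.2 hd)
  have hbeq : Nat.beq d 0 = false := by cases d; exact absurd rfl hd0; rfl
  rw [hbeq] at h
  simp only [force_eq, Bool.false_or, Bool.and_eq_true, decide_eq_true_eq, List.any_eq_true] at h
  obtain ⟨⟨hr, hs⟩, t, ht, htr⟩ := h
  exact ⟨hr, hs, blk_mem_development_of_hasTranslateIn ht (hL t ht) htr⟩

/-- At most four base blocks of size `4` have at most `48` ordered differences in total. If a line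
table shows that each of the `48` nonzero elements occurs among them, then each occurs once. -/
theorem isDifferenceFamily_codeFamily {L : List (ℕ × ℕ × ℕ)} {T : ℕ} (hlen : L.length ≤ 4)
    (hcard : ∀ t ∈ L, #(blk t) = 4) (hT : IsLineTable T (development (codeFamily L))) :
    IsDifferenceFamily 49 4 (codeFamily L) := by
  have h4 : ∀ B ∈ codeFamily L, #B = 4 := by
    intro B hB
    obtain ⟨t, ht, rfl⟩ := mem_codeFamily.1 hB
    exact hcard t ht
  have hF : #(codeFamily L) ≤ 4 := by
    refine (List.toFinset_card_le _).trans ?_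
    rwa [List.length_map]
  have hcov : ∀ d ∈ univ.erase (0 : Plane), 1 ≤ ∑ B ∈ codeFamily L, partialDiffCount B d := by
    intro d hd
    have hd0 : d ≠ 0 := ne_of_mem_erase hd
    have hc0 : code d ≠ 0 := fun h => hd0 (by rw [← pt_code d, h, pt_zero])
    obtain ⟨B, hB, g, hg⟩ := mem_development.1 (hT _ (code_lt d) hc0).2.2
    have h0 : (0 : Plane) - g ∈ B := mem_translateBlock.1 (by rw [hg]; simp [blk])
    have h1 : d - g ∈ B := mem_translateBlock.1 (by rw [hg]; simp [blk])
    refine le_trans ?_ (single_le_sum (fun _ _ => Nat.zero_le _) hB)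
    rw [partialDiffCount_eq (h4 B hB), Nat.one_le_iff_ne_zero, Finset.card_ne_zero]
    exact ⟨(d - g, 0 - g), by simp [h0, h1, -zero_sub]⟩
  have htot : ∑ d ∈ univ.erase (0 : Plane), ∑ B ∈ codeFamily L, partialDiffCount B d ≤
      ∑ d ∈ univ.erase (0 : Plane), 1 := by
    rw [sum_comm]
    calc ∑ B ∈ codeFamily L, ∑ d ∈ univ.erase (0 : Plane), partialDiffCount B d
        = ∑ B ∈ codeFamily L, 12 := by
          refine sum_congr rfl fun B hB => ?_
          have hoff : #B.offDiag = 12 := by rw [offDiag_card, h4 B hB]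
          rw [← hoff, card_eq_sum_card_fiberwise (f := fun q : Plane × Plane => q.1 - q.2)
            (t := univ.erase 0)]
          · refine sum_congr rfl fun d hd => ?_
            rw [partialDiffCount_eq (h4 B hB)]
            congr 1
            ext q
            simp only [mem_filter, mem_product, mem_offDiag]
            constructor
            · rintro ⟨⟨h1, h2⟩, h3⟩
              refine ⟨⟨h1, h2, fun h => ne_of_mem_erase hd ?_⟩, h3⟩
              rw [← h3, h, sub_self]
            · rintro ⟨⟨h1, h2, -⟩, h3⟩
              exact ⟨⟨h1, h2⟩, h3⟩
          · intro q hq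
            simp only [mem_coe, mem_offDiag] at hq
            simpa [sub_eq_zero] using hq.2.2
      _ ≤ 48 := by rw [sum_const, smul_eq_mul]; omega
      _ = ∑ d ∈ univ.erase (0 : Plane), 1 := by decide
  refine ⟨by decide, h4, fun d hd => ?_⟩
  exact ((sum_eq_sum_iff_of_le hcov).1 (le_antisymm (sum_le_sum hcov) htot) d
    (mem_erase.2 ⟨hd, mem_univ _⟩)).symm

/-- The line table of the development of a listed family. -/
def listedTable (i : Fin 12) : ℕ := lineTable (listedCodes i)

theorem listedTable_spec (i : Fin 12) : (listedCodes i).length ≤ 4 ∧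
    (∀ t ∈ listedCodes i, #(blk t) = 4) ∧
    IsLineTable (listedTable i) (development (listedFamilies i).family) := by
  rw [listedFamilies_family]
  refine tableCheck_spec ?_
  rw [← force_eq (listedTable i) (tableCheck _)]
  exact tableCheck_listed i

theorem listedFamilies_isDifferenceFamily (i : Fin 12) :
    IsDifferenceFamily 49 4 (listedFamilies i).family := by
  obtain ⟨h1, h2, h3⟩ := listedTable_spec i
  rw [listedFamilies_family] at h3 ⊢
  exact isDifferenceFamily_codeFamily h1 h2 h3

theorem listedFamilies_isInvariantSteiner (i : Fin 12) :
    IsInvariantSteiner (development (listedFamilies i).family) :=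
  (listedFamilies_isDifferenceFamily i).isInvariantSteiner

/-! ### Multipliers -/

/-- The number of automorphisms that map all blocks `blk t`, `t ∈ L`, into the block system with
line table `T`. -/
def multiplierCount (L : List (ℕ × ℕ × ℕ)) (T : ℕ) : ℕ :=
  sumBelow 49 fun u => sumBelow 49 fun v =>
    cond (dependent u v) 0 (cond (L.all (mapsInto T u v)) 1 0)

theorem development_mapBlocks_eq_iff {F : Finset (Finset Plane)} (hF : IsDifferenceFamily 49 4 F)
    {𝓒 : Finset (Finset Plane)} (h𝓒 : IsInvariantSteiner 𝓒) (α : Plane ≃+ Plane) :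
    development (mapBlocks α F) = 𝓒 ↔ ∀ B ∈ F, B.image α ∈ 𝓒 := by
  rw [development_mapBlocks]
  constructor
  · rintro rfl B hB
    exact mem_mapBlocks.2 ⟨B, mem_development.2 ⟨B, hB, 0, by simp [translateBlock]⟩, rfl⟩
  · intro h
    refine (hF.isInvariantSteiner.mapBlocks α).steiner.eq_of_subset (by norm_num) h𝓒.steiner ?_
    intro C hC
    obtain ⟨_, hC', rfl⟩ := mem_mapBlocks.1 hC
    obtain ⟨B, hB, g, rfl⟩ := mem_development.1 hC'
    rw [translateBlock_image]
    exact h𝓒.translate_mem _ (h B hB) _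

/-- The automorphism that sends `(1, 0)` and `(0, 1)` to `w.1` and `w.2` exists, and it maps each
`blk t`, `t ∈ L`, to a block of the development. -/
def IsMultiplierPair (L : List (ℕ × ℕ × ℕ)) (w : Plane × Plane) : Prop :=
  ∃ h : matDet w.1 w.2 ≠ 0,
    ∀ t ∈ L, (blk t).image (matAut w.1 w.2 h) ∈ development (codeFamily L)

theorem multiplierNumber_eq_card {L : List (ℕ × ℕ × ℕ)}
    (hF : IsDifferenceFamily 49 4 (codeFamily L)) :
    multiplierNumber (codeFamily L) = Nat.card {w // IsMultiplierPair L w} := by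
  refine Nat.card_congr ((Equiv.subtypeEquiv autEquiv fun α => ?_).trans
    (Equiv.subtypeSubtypeEquivSubtypeExists (fun w : Plane × Plane => matDet w.1 w.2 ≠ 0)
      fun w => ∀ t ∈ L, (blk t).image (matAut w.1.1 w.1.2 w.2) ∈ development (codeFamily L)))
  have hα : matAut (autEquiv α).1.1 (autEquiv α).1.2 (autEquiv α).2 = α := autEquiv.left_inv α
  rw [hα, development_mapBlocks_eq_iff hF hF.isInvariantSteiner]
  simp only [mem_codeFamily, forall_exists_index, and_imp, forall_apply_eq_imp_iff₂]

theorem multiplierNumber_eq {L : List (ℕ × ℕ × ℕ)} {T : ℕ}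
    (hcard : ∀ t ∈ L, #(blk t) = 4) (hT : IsLineTable T (development (codeFamily L)))
    (hF : IsDifferenceFamily 49 4 (codeFamily L)) :
    multiplierNumber (codeFamily L) = multiplierCount L T := by
  classical
  have hS := hF.isInvariantSteiner
  rw [multiplierNumber_eq_card hF,
    Nat.subtype_card (univ.filter (IsMultiplierPair L)) (by simp), card_filter,
    Fintype.sum_prod_type, sum_plane_eq, multiplierCount, sumBelow_eq]
  refine sum_congr rfl fun u _ => ?_
  rw [sum_plane_eq, sumBelow_eq]
  refine sum_congr rfl fun v _ => ?_
  rcases hdep : dependent u v with _ | _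
  · have hdet := (dependent_eq_false u v).1 hdep
    have hiff : IsMultiplierPair L (pt u, pt v) ↔ L.all (mapsInto T u v) = true := by
      rw [List.all_eq_true]
      constructor
      · rintro ⟨_, h⟩ t ht
        exact (mapsInto_iff hT hS.steiner hdet (hcard t ht)).2 (h t ht)
      · intro h
        exact ⟨hdet, fun t ht => (mapsInto_iff hT hS.steiner hdet (hcard t ht)).1 (h t ht)⟩
    by_cases hQ : IsMultiplierPair L (pt u, pt v)
    · rw [if_pos hQ, hiff.1 hQ]; rfl
    · rw [if_neg hQ, Bool.eq_false_iff.2 (mt hiff.2 hQ)]; rfl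
  · have : ¬ IsMultiplierPair L (pt u, pt v) := fun ⟨h, _⟩ => by
      rw [(dependent_eq_false u v).2 h] at hdep
      exact absurd hdep (by decide)
    rw [if_neg this]; rfl

theorem multiplierCount_listed (i : Fin 12) :
    force (listedTable i) (multiplierCount (listedCodes i)) = (listedFamilies i).multiplier := by
  revert i
  decide +kernel

theorem listedFamilies_multiplierNumber (i : Fin 12) :
    multiplierNumber (listedFamilies i).family = (listedFamilies i).multiplier := by
  have hF := listedFamilies_isDifferenceFamily i
  obtain ⟨-, h2, h3⟩ := listedTable_spec i
  rw [listedFamilies_family] at hF h3 ⊢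
  rw [multiplierNumber_eq h2 h3 hF, ← multiplierCount_listed, force_eq]

/-! ### Fingerprints -/

theorem IsSteinerSystem.blockLine_eq {X : Type*} [Fintype X] [DecidableEq X] {v k : ℕ}
    {𝓑 : Finset (Finset X)} (h : IsSteinerSystem v k 𝓑) {B : Finset X} (hB : B ∈ 𝓑) {x y : X}
    (hxy : x ≠ y) (hx : x ∈ B) (hy : y ∈ B) : blockLine 𝓑 x y = B := by
  ext z
  simp only [blockLine, mem_filter, mem_univ, true_and]
  constructor
  · rintro ⟨C, hC, hxC, hyC, hz⟩
    rwa [h.eq_of_mem hB hC hxy hx hy hxC hyC]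
  · exact fun hz => ⟨B, hB, hx, hy, hz⟩

section LineTable

variable {T : ℕ} {𝓑 : Finset (Finset Plane)}

theorem IsLineTable.blockLine_zero (hT : IsLineTable T 𝓑) (h : IsSteinerSystem 49 4 𝓑) {x : ℕ}
    (hx : x < 49) (hx0 : x ≠ 0) : blockLine 𝓑 0 (pt x) = blk (x, third T x, fourth T x) :=
  h.blockLine_eq (hT x hx hx0).2.2 (pt_ne_zero hx hx0).symm (by simp [blk]) (by simp [blk])

theorem IsLineTable.blockLine_eq (hT : IsLineTable T 𝓑) (h : IsInvariantSteiner 𝓑) {p q : ℕ}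
    (hp : p < 49) (hq : q < 49) (hpq : p ≠ q) :
    blockLine 𝓑 (pt p) (pt q) = {pt p, pt q, pt (addC p (third T (subC q p))),
      pt (addC p (fourth T (subC q p)))} ∧
    blockLine 𝓑 (pt p) (pt q) ∈ 𝓑 := by
  have hd : pt (subC q p) = pt q - pt p := pt_subC q hp
  have hne : pt p ≠ pt q := fun h => hpq ((pt_inj hp hq).1 h)
  have hd0 : subC q p ≠ 0 := fun h0 => hne (sub_eq_zero.1 (by rw [← hd, h0, pt_zero])).symm
  have hm := h.translate_mem _ (hT _ (subC_lt q p) hd0).2.2 (pt p)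
  have : translateBlock (blk (subC q p, third T (subC q p), fourth T (subC q p))) (pt p) =
      {pt p, pt q, pt (addC p (third T (subC q p))), pt (addC p (fourth T (subC q p)))} := by
    simp [translateBlock, blk, image_insert, hd, pt_addC, add_comm]
  rw [this] at hm
  have he := h.steiner.blockLine_eq hm hne (by simp) (by simp)
  exact ⟨he, by rwa [he]⟩

/-- Tests whether `z` is one of `0`, `x`, `r`, `s`. -/
def onLine (x r s z : ℕ) : Bool := cond (oneOf 0 x z) true (oneOf r s z)

theorem onLine_eq (hT : IsLineTable T 𝓑) (h : IsSteinerSystem 49 4 𝓑) {x z : ℕ}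
    (hx : x < 49) (hx0 : x ≠ 0) (hz : z < 49) :
    onLine x (third T x) (fourth T x) z = true ↔ pt z ∈ blockLine 𝓑 0 (pt x) := by
  obtain ⟨hr, hs, -⟩ := hT x hx hx0
  rw [hT.blockLine_zero h hx hx0, mem_blk, ← pt_zero, pt_inj hz (by norm_num), pt_inj hz hx,
    pt_inj hz hr, pt_inj hz hs]
  have h1 := oneOf_eq 0 x z
  have h2 := oneOf_eq (third T x) (fourth T x) z
  unfold onLine
  cases h01 : oneOf 0 x z
  · have h3 : ¬ (z = 0 ∨ z = x) := fun h => by rw [h1.2 h] at h01; exact absurd h01 (by decide)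
    rw [cond_false, h2]
    tauto
  · rw [cond_true]
    have := h1.1 h01
    tauto

/-- This is `1` if the line through `p` and `q` does not meet the line with the points
`0`, `x`, `r`, `s`, which contains neither `p` nor `q`, and `0` otherwise. -/
def missing (T x r s p q : ℕ) : ℕ :=
  force (subC q p) fun d => cond (onLine x r s (addC p (third T d))) 0
    (cond (onLine x r s (addC p (fourth T d))) 0 1)

theorem missing_eq (hT : IsLineTable T 𝓑) (h : IsInvariantSteiner 𝓑) {x p q : ℕ}
    (hx : x < 49) (hx0 : x ≠ 0) (hp : p < 49) (hq : q < 49) (hpq : p ≠ q)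
    (hpx : pt p ∉ blockLine 𝓑 0 (pt x)) (hqx : pt q ∉ blockLine 𝓑 0 (pt x)) :
    missing T x (third T x) (fourth T x) p q =
      if Disjoint (blockLine 𝓑 (pt p) (pt q)) (blockLine 𝓑 0 (pt x)) then 1 else 0 := by
  have h1 := onLine_eq hT h.steiner hx hx0 (addC_lt p (third T (subC q p)))
  have h2 := onLine_eq hT h.steiner hx hx0 (addC_lt p (fourth T (subC q p)))
  have hdis : Disjoint (blockLine 𝓑 (pt p) (pt q)) (blockLine 𝓑 0 (pt x)) ↔
      pt (addC p (third T (subC q p))) ∉ blockLine 𝓑 0 (pt x) ∧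
      pt (addC p (fourth T (subC q p))) ∉ blockLine 𝓑 0 (pt x) := by
    rw [(hT.blockLine_eq h hp hq hpq).1]
    simp [hpx, hqx]
  rw [missing, force_eq]
  cases h3 : onLine x (third T x) (fourth T x) (addC p (third T (subC q p)))
  · rw [h3] at h1
    cases h4 : onLine x (third T x) (fourth T x) (addC p (fourth T (subC q p)))
    · rw [h4] at h2
      rw [if_pos (hdis.2 ⟨fun h => absurd (h1.2 h) (by decide),
        fun h => absurd (h2.2 h) (by decide)⟩)]
      rfl
    · rw [if_neg fun h => (hdis.1 h).2 (h2.1 h4)]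
      rfl
  · rw [if_neg fun h => (hdis.1 h).1 (h1.1 h3)]
    rfl

/-- The value of `nonMeetingCount` at `0`, `x`, `y`, `p`, from the third and fourth point `r` and
`s` of the line through `0` and `x`. -/
def missingCount (T x r s y p : ℕ) : ℕ :=
  Nat.add (missing T x r s p (third T y)) (missing T x r s p (fourth T y))

/-- Of the points on the line `0y`, only the third and the fourth can contribute to
`nonMeetingCount`. -/
theorem missingCount_eq (hT : IsLineTable T 𝓑) (h : IsInvariantSteiner 𝓑) {x y p : ℕ}
    (hx : x < 49) (hx0 : x ≠ 0) (hy : y < 49) (hp : p < 49)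
    (hxy : pt y ∉ blockLine 𝓑 0 (pt x)) (hpl : pt p ∈ blockLine 𝓑 (pt x) (pt y))
    (hpx : p ≠ x) (hpy : p ≠ y) :
    nonMeetingCount 𝓑 0 (pt x) (pt y) (pt p) =
      missingCount T x (third T x) (fourth T x) y p := by
  have hS := h.steiner
  have hl1 := hT.blockLine_zero hS hx hx0
  have hm1 := (hT x hx hx0).2.2
  rw [← hl1] at hm1
  have h01 : (0 : Plane) ∈ blockLine 𝓑 0 (pt x) := by rw [hl1]; simp [blk]
  have hx1 : pt x ∈ blockLine 𝓑 0 (pt x) := by rw [hl1]; simp [blk]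
  have hy0 : y ≠ 0 := fun h => hxy (by rw [h, pt_zero]; exact h01)
  obtain ⟨hr, hs, hm2⟩ := hT y hy hy0
  have hl2 := hT.blockLine_zero hS hy hy0
  have hc2 := card_blk.1 (hS.2.1 _ hm2)
  have hxy' : x ≠ y := fun h => hxy (h ▸ hx1)
  obtain ⟨hl3, hm3⟩ := hT.blockLine_eq h hx hy hxy'
  have hx3 : pt x ∈ blockLine 𝓑 (pt x) (pt y) := by rw [hl3]; simp
  have hy3 : pt y ∈ blockLine 𝓑 (pt x) (pt y) := by rw [hl3]; simp
  have hnpx : pt p ≠ pt x := fun h => hpx ((pt_inj hp hx).1 h)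
  have hnpy : pt p ≠ pt y := fun h => hpy ((pt_inj hp hy).1 h)
  -- The lines `0x`, `0y` and `xy` are distinct, so that they meet in `0`, `x` and `y` only.
  have hp1 : pt p ∉ blockLine 𝓑 0 (pt x) := fun hmem => by
    rw [hS.eq_of_mem hm1 hm3 hnpx hmem hx1 hpl hx3] at hxy
    exact hxy hy3
  have hp2 : pt p ∉ blk (y, third T y, fourth T y) := fun hmem => by
    have he := hS.eq_of_mem hm2 hm3 hnpy hmem (by simp [blk]) hpl hy3
    have hx2 : pt x ∈ blk (y, third T y, fourth T y) := by rwa [he]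
    have := hS.eq_of_mem hm1 hm2 (pt_ne_zero hx hx0) hx1 h01 hx2 (by simp [blk])
    rw [this] at hxy
    exact hxy (by simp [blk])
  have hoff : ∀ u, pt u ∈ blk (y, third T y, fourth T y) → pt u ≠ 0 →
      pt u ∉ blockLine 𝓑 0 (pt x) := fun u hu hu0 hmem => by
    rw [hS.eq_of_mem hm1 hm2 hu0 hmem h01 hu (by simp [blk])] at hxy
    exact hxy (by simp [blk])
  have hpr : p ≠ third T y := fun h => hp2 (by rw [h]; simp [blk])
  have hps : p ≠ fourth T y := fun h => hp2 (by rw [h]; simp [blk])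
  have hp0 : p ≠ 0 := fun h => hp1 (by rw [h, pt_zero]; exact h01)
  -- The line from `p` to `0` meets the line `0x` in `0`, the line from `p` to `y` meets it in `x`.
  have hd0 : ¬ Disjoint (blockLine 𝓑 (pt p) 0) (blockLine 𝓑 0 (pt x)) := by
    rw [← pt_zero, (hT.blockLine_eq h hp (by norm_num) hp0).1, not_disjoint_iff]
    exact ⟨pt 0, by simp, by rw [pt_zero]; exact h01⟩
  have hdy : ¬ Disjoint (blockLine 𝓑 (pt p) (pt y)) (blockLine 𝓑 0 (pt x)) := by
    rw [hS.blockLine_eq hm3 hnpy hpl hy3, not_disjoint_iff]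
    exact ⟨pt x, hx3, hx1⟩
  rw [missingCount, missing_eq hT h hx hx0 hp hr hpr hp1 (hoff _ (by simp [blk]) hc2.2.1),
    missing_eq hT h hx hx0 hp hs hps hp1 (hoff _ (by simp [blk]) hc2.2.2.1), nonMeetingCount, hl2,
    card_filter, blk, sum_insert, sum_insert, sum_pair hc2.2.2.2.2.2, if_neg hd0, if_neg hdy,
    zero_add, zero_add]
  · rfl
  · simp [hc2.2.2.2.1, hc2.2.2.2.2.1]
  · simp [hc2.1.symm, hc2.2.1.symm, hc2.2.2.1.symm]

theorem missing_le_one (x r s p q : ℕ) : missing T x r s p q ≤ 1 := by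
  rw [missing, force_eq]
  cases onLine x r s (addC p (third T (subC q p)))
  · cases onLine x r s (addC p (fourth T (subC q p))) <;> simp
  · simp

/-- The contribution of `p` to `histogram`. -/
def histogramEntry (w : ℕ → ℕ) (T x r s y p : ℕ) : ℕ :=
  force p fun p => force (missingCount T x r s y p) w

/-- The sum of `w k` over all triples `(x, y, p)` that contribute to the fingerprint together with
the origin, where `k` is the value of `nonMeetingCount`. -/
def histogram (w : ℕ → ℕ) (T : ℕ) : ℕ :=
  sumBelow 49 fun x => cond (Nat.beq x 0) 0 <|
    force (third T x) fun r => force (fourth T x) fun s => sumBelow 49 fun y =>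
      cond (onLine x r s y) 0 <|
        Nat.add (histogramEntry w T x r s y (addC x (third T (subC y x))))
          (histogramEntry w T x r s y (addC x (fourth T (subC y x))))

/-- The triples `(x, y, p)` that contribute to the fingerprint together with the origin. -/
def originTriples (𝓑 : Finset (Finset Plane)) : Finset (Plane × Plane × Plane) :=
  {t | ¬ BlockCollinear 𝓑 0 t.1 t.2.1 ∧ t.2.2 ∈ blockLine 𝓑 t.1 t.2.1 ∧
    t.2.2 ≠ t.1 ∧ t.2.2 ≠ t.2.1}

theorem mem_originTriples {t : Plane × Plane × Plane} : t ∈ originTriples 𝓑 ↔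
    ¬ BlockCollinear 𝓑 0 t.1 t.2.1 ∧ t.2.2 ∈ blockLine 𝓑 t.1 t.2.1 ∧
    t.2.2 ≠ t.1 ∧ t.2.2 ≠ t.2.1 := by simp [originTriples]

theorem blockCollinear_zero_zero (h : IsSteinerSystem 49 4 𝓑) (y : Plane) :
    BlockCollinear 𝓑 0 0 y := by
  have : ∃ z : Plane, 0 ≠ z ∧ (y = 0 ∨ y = z) := by
    by_cases hy : y = 0
    · exact ⟨(1, 0), by decide, Or.inl hy⟩
    · exact ⟨y, Ne.symm hy, Or.inr rfl⟩
  obtain ⟨z, hz, hyz⟩ := this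
  obtain ⟨B, ⟨hB, h0, hzB⟩, -⟩ := h.2.2 0 z hz
  exact ⟨B, hB, h0, h0, by rcases hyz with rfl | rfl <;> assumption⟩

theorem sum_originTriples (hT : IsLineTable T 𝓑) (h : IsInvariantSteiner 𝓑) (w : ℕ → ℕ) :
    ∑ t ∈ originTriples 𝓑, w (nonMeetingCount 𝓑 0 t.1 t.2.1 t.2.2) = histogram w T := by
  have hS := h.steiner
  rw [originTriples, sum_filter, Fintype.sum_prod_type, sum_plane_eq, histogram, sumBelow_eq]
  refine sum_congr rfl fun x hx => ?_
  rw [mem_range] at hx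
  rw [Fintype.sum_prod_type]
  rcases eq_or_ne x 0 with rfl | hx0
  · simp only [pt_zero]
    refine (sum_eq_zero fun y _ => sum_eq_zero fun p _ => if_neg fun hc => ?_).trans rfl
    exact hc.1 (blockCollinear_zero_zero hS y)
  have hbeq : Nat.beq x 0 = false := by cases x; exact absurd rfl hx0; rfl
  rw [hbeq, cond_false, force_eq, force_eq, sum_plane_eq, sumBelow_eq]
  refine sum_congr rfl fun y hy => ?_
  rw [mem_range] at hy
  have hon := onLine_eq hT hS hx hx0 hy
  have hcol : BlockCollinear 𝓑 0 (pt x) (pt y) ↔ pt y ∈ blockLine 𝓑 0 (pt x) := by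
    simp [blockLine]
  cases hl : onLine x (third T x) (fourth T x) y
  · have hxy : pt y ∉ blockLine 𝓑 0 (pt x) := fun hm => by
      rw [hon.2 hm] at hl
      exact absurd hl (by decide)
    have hxy' : x ≠ y := by
      rintro rfl
      exact hxy (by rw [hT.blockLine_zero hS hx hx0]; simp [blk])
    obtain ⟨hl3, hm3⟩ := hT.blockLine_eq h hx hy hxy'
    have hcard := hS.2.1 _ hm3
    have hl3' := hl3
    rw [hl3, card_four_iff] at hcard
    obtain ⟨-, h13, h14, h23, h24, h34⟩ := hcard
    have hp := addC_lt x (third T (subC y x))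
    have hq := addC_lt x (fourth T (subC y x))
    have hw : ∀ p < 49, pt p ∈ blockLine 𝓑 (pt x) (pt y) → pt x ≠ pt p → pt y ≠ pt p →
        histogramEntry w T x (third T x) (fourth T x) y p =
          w (nonMeetingCount 𝓑 0 (pt x) (pt y) (pt p)) := by
      intro p hp hpl hpx hpy
      rw [missingCount_eq hT h hx hx0 hy hp hxy hpl (fun h => hpx (by rw [h]))
        (fun h => hpy (by rw [h])), histogramEntry, force_eq, force_eq]
    rw [cond_false, hw _ hp (by rw [hl3]; simp) h13 h23, hw _ hq (by rw [hl3]; simp) h14 h24,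
      ← sum_filter]
    refine Eq.trans (sum_congr ?_ fun _ _ => rfl) (sum_pair h34)
    ext z
    simp only [hcol, hxy, not_false_eq_true, true_and, mem_filter, mem_univ, hl3, mem_insert,
      mem_singleton]
    constructor
    · rintro ⟨h1, h2, h3⟩
      tauto
    · rintro (hz | hz) <;> rw [hz]
      · exact ⟨Or.inr (Or.inr (Or.inl rfl)), h13.symm, h23.symm⟩
      · exact ⟨Or.inr (Or.inr (Or.inr rfl)), h14.symm, h24.symm⟩
  · refine (sum_eq_zero fun p _ => if_neg fun hc => ?_).trans rfl
    exact hc.1 (hcol.2 (hon.1 hl))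

theorem nonMeetingCount_le_two (hT : IsLineTable T 𝓑) (h : IsInvariantSteiner 𝓑)
    {t : Plane × Plane × Plane} (ht : t ∈ originTriples 𝓑) :
    nonMeetingCount 𝓑 0 t.1 t.2.1 t.2.2 ≤ 2 := by
  obtain ⟨hc, hl, h1, h2⟩ := mem_originTriples.1 ht
  obtain ⟨x, y, p⟩ := t
  rw [← pt_code x, ← pt_code y, ← pt_code p] at *
  simp only at hc hl h1 h2 ⊢
  have hx0 : code x ≠ 0 := fun h0 => hc (by
    rw [h0, pt_zero]; exact blockCollinear_zero_zero h.steiner _)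
  rw [missingCount_eq hT h (code_lt x) hx0 (code_lt y) (code_lt p) (by simpa [blockLine] using hc)
    hl (fun h => h1 (by rw [h])) (fun h => h2 (by rw [h]))]
  exact Nat.add_le_add (missing_le_one _ _ _ _ _) (missing_le_one _ _ _ _ _)

theorem card_originTriples_le (hT : IsLineTable T 𝓑) (h : IsInvariantSteiner 𝓑) :
    #(originTriples 𝓑) ≤ 4802 := by
  have h1 := sum_originTriples hT h fun _ => 1
  rw [← card_eq_sum_ones] at h1
  rw [h1, histogram, sumBelow_eq]
  refine (sum_le_card_nsmul (range 49) _ 98 fun x _ => ?_).trans (by simp)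
  cases Nat.beq x 0
  · rw [cond_false, force_eq, force_eq, sumBelow_eq]
    refine (sum_le_card_nsmul (range 49) _ 2 fun y _ => ?_).trans (by simp)
    cases onLine x (third T x) (fourth T x) y
    · rw [cond_false, histogramEntry, histogramEntry, force_eq, force_eq, force_eq, force_eq]
    · simp
  · simp

theorem pointFrequency_eq_card (n : ℕ) : pointFrequency 𝓑 0 n =
    #{t ∈ originTriples 𝓑 | nonMeetingCount 𝓑 0 t.1 t.2.1 t.2.2 = n} := by
  rw [pointFrequency, originTriples, filter_filter]
  simp only [and_assoc]

theorem pointFrequency_add_three (hT : IsLineTable T 𝓑) (h : IsInvariantSteiner 𝓑) (n : ℕ) :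
    pointFrequency 𝓑 0 (n + 3) = 0 := by
  rw [pointFrequency_eq_card, card_eq_zero, filter_eq_empty_iff]
  intro t ht hn
  have := nonMeetingCount_le_two hT h ht
  omega

/-- The three frequencies can be read from one number. They are its digits in base `8192`, since
`originTriples` has at most `4802` members. -/
theorem histogram_eq (hT : IsLineTable T 𝓑) (h : IsInvariantSteiner 𝓑) :
    histogram (Nat.pow 8192) T = pointFrequency 𝓑 0 0 + 8192 * pointFrequency 𝓑 0 1 +
      8192 ^ 2 * pointFrequency 𝓑 0 2 := by
  rw [← sum_originTriples hT h, pointFrequency_eq_card, pointFrequency_eq_card,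
    pointFrequency_eq_card, card_filter, card_filter, card_filter, mul_sum, mul_sum,
    ← sum_add_distrib, ← sum_add_distrib]
  refine sum_congr rfl fun t ht => ?_
  have := nonMeetingCount_le_two hT h ht
  generalize nonMeetingCount 𝓑 0 t.1 t.2.1 t.2.2 = k at *
  rw [Nat.pow_eq]
  interval_cases k <;> norm_num

theorem hyperbolicFrequency_eq_fingerprint (hT : IsLineTable T 𝓑) (h : IsInvariantSteiner 𝓑)
    {f : ℕ → ℕ} (hf : ∀ n, f (n + 3) = 0) {a b c : ℕ} (h0 : f 0 = 49 * a) (h1 : f 1 = 49 * b)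
    (h2 : f 2 = 49 * c) (ha : a < 8192) (hb : b < 8192)
    (hh : histogram (Nat.pow 8192) T = a + 8192 * b + 8192 ^ 2 * c) (n : ℕ) :
    hyperbolicFrequency 𝓑 n = f n := by
  have hle : ∀ n, pointFrequency 𝓑 0 n < 8192 := fun n => by
    rw [pointFrequency_eq_card]
    exact ((card_filter_le _ _).trans (card_originTriples_le hT h)).trans_lt (by norm_num)
  rw [histogram_eq hT h] at hh
  have l0 := hle 0
  have l1 := hle 1
  rw [h.hyperbolicFrequency_eq]
  match n with
  | 0 => omega
  | 1 => omega
  | 2 => omega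
  | n + 3 =>
    rw [hf, pointFrequency_add_three hT h, mul_zero]

end LineTable

theorem histogram_listed (i : Fin 12) :
    let f := (listedFamilies i).frequency
    f 0 % 49 = 0 ∧ f 1 % 49 = 0 ∧ f 2 % 49 = 0 ∧ f 0 / 49 < 8192 ∧ f 1 / 49 < 8192 ∧
    force (listedTable i) (histogram (Nat.pow 8192)) =
      f 0 / 49 + 8192 * (f 1 / 49) + 8192 ^ 2 * (f 2 / 49) := by
  revert i
  decide +kernel

theorem listedFamilies_hyperbolicFrequency (i : Fin 12) (n : ℕ) :
    hyperbolicFrequency (development (listedFamilies i).family) n =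
      (listedFamilies i).frequency n := by
  obtain ⟨h0, h1, h2, ha, hb, hh⟩ := histogram_listed i
  rw [force_eq] at hh
  refine hyperbolicFrequency_eq_fingerprint (listedTable_spec i).2.2
    (listedFamilies_isInvariantSteiner i) (fun n => ?_) (by omega) (by omega) (by omega) ha hb hh n
  fin_cases i <;> rfl

/-! ### Inequivalence -/

theorem not_blocksIsomorphic_listed (i j : Fin 12) (hij : i ≠ j) :
    ¬ BlocksIsomorphic (development (listedFamilies i).family)
      (development (listedFamilies j).family) := by
  rintro ⟨e, he⟩
  have hf : ∀ n, (listedFamilies i).frequency n = (listedFamilies j).frequency n := fun n => by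
    rw [← listedFamilies_hyperbolicFrequency, ← listedFamilies_hyperbolicFrequency, ← he,
      hyperbolicFrequency_mapBlocks]
  have hne : ∀ i j : Fin 12, i ≠ j →
      ¬ ((listedFamilies i).frequency 0 = (listedFamilies j).frequency 0 ∧
        (listedFamilies i).frequency 1 = (listedFamilies j).frequency 1) := by
    decide +kernel
  exact hne i j hij ⟨hf 0, hf 1⟩

theorem not_multiplierEquivalent_listed (i j : Fin 12) (hij : i ≠ j) :
    ¬ MultiplierEquivalent (listedFamilies i).family (listedFamilies j).family := by
  rintro ⟨α, hα⟩
  rw [development_mapBlocks] at hα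
  exact not_blocksIsomorphic_listed i j hij ⟨α.toEquiv, hα⟩

/-! ### Recording differences in a bit mask -/

/-- The binary digit `x` of `U`. -/
def hasBit (U x : ℕ) : Bool := Nat.beq (Nat.land (Nat.shiftRight U x) 1) 1

/-- Sets the binary digits `x` and `-x` of `U`. -/
def mark (U x : ℕ) : ℕ := Nat.lor U (Nat.lor (Nat.shiftLeft 1 x) (Nat.shiftLeft 1 (subC 0 x)))

theorem hasBit_eq (U x : ℕ) : hasBit U x = U.testBit x := by
  have h : hasBit U x = Nat.beq ((U >>> x) &&& 1) 1 := rfl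
  rw [h, Nat.testBit_eq_decide_div_mod_eq, Nat.and_one_is_mod, Nat.shiftRight_eq_div_pow,
    Bool.eq_iff_iff, decide_eq_true_eq]
  exact iff_of_eq Nat.beq_eq

theorem hasBit_mark (U x y : ℕ) :
    hasBit (mark U x) y = true ↔ hasBit U y = true ∨ y = x ∨ y = subC 0 x := by
  have h : mark U x = U ||| (1 <<< x ||| 1 <<< subC 0 x) := rfl
  have h1 : ∀ z, (1 <<< z).testBit y = true ↔ y = z := fun z => by
    rw [Nat.one_shiftLeft, Nat.testBit_two_pow, decide_eq_true_eq, eq_comm]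
  rw [hasBit_eq, hasBit_eq, h, Nat.testBit_or, Nat.testBit_or, Bool.or_eq_true, Bool.or_eq_true,
    h1, h1]

/-- Marks the differences of the block `blk (d, c, e)`. -/
def markBlock (U d c e : ℕ) : ℕ :=
  mark (mark (mark (mark (mark (mark U d) c) (subC c d)) e) (subC e d)) (subC e c)

/-- The mask `U` records the differences of the blocks `blk t`, `t ∈ ts`, together with `0`. -/
def Records (U : ℕ) (ts : List (ℕ × ℕ × ℕ)) : Prop :=
  ∀ x < 49, hasBit U x = true ↔
    x = 0 ∨ ∃ t ∈ ts, ∃ p ∈ blk t, ∃ q ∈ blk t, pt x = q - p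

theorem records_one : Records 1 [] := by
  intro x hx
  have : ∀ x < 49, hasBit 1 x = true ↔ x = 0 := by decide
  simpa using this x hx

theorem Records.cons {U : ℕ} {ts : List (ℕ × ℕ × ℕ)} (h : Records U ts) {d c e : ℕ}
    (hd : d < 49) (hc : c < 49) (he : e < 49) :
    Records (markBlock U d c e) ((d, c, e) :: ts) := by
  intro x hx
  have key : (∃ p ∈ blk (d, c, e), ∃ q ∈ blk (d, c, e), pt x = q - p) ↔
      x = 0 ∨ (x = d ∨ x = subC 0 d) ∨ (x = c ∨ x = subC 0 c) ∨
      (x = subC c d ∨ x = subC 0 (subC c d)) ∨ (x = e ∨ x = subC 0 e) ∨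
      (x = subC e d ∨ x = subC 0 (subC e d)) ∨ (x = subC e c ∨ x = subC 0 (subC e c)) := by
    have hlt := subC_lt
    rw [← pt_inj hx (n := 0) (by norm_num), ← pt_inj hx hd, ← pt_inj hx hc, ← pt_inj hx he,
      ← pt_inj hx (hlt 0 d), ← pt_inj hx (hlt 0 c), ← pt_inj hx (hlt 0 e), ← pt_inj hx (hlt c d),
      ← pt_inj hx (hlt e d), ← pt_inj hx (hlt e c), ← pt_inj hx (hlt 0 (subC c d)),
      ← pt_inj hx (hlt 0 (subC e d)), ← pt_inj hx (hlt 0 (subC e c)), pt_subC 0 hd, pt_subC 0 hc,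
      pt_subC 0 he, pt_subC 0 (hlt c d), pt_subC 0 (hlt e d), pt_subC 0 (hlt e c), pt_subC c hd,
      pt_subC e hd, pt_subC e hc]
    have m0 : (0 : Plane) ∈ blk (d, c, e) := by simp [blk]
    have md : pt d ∈ blk (d, c, e) := by simp [blk]
    have mc : pt c ∈ blk (d, c, e) := by simp [blk]
    have me : pt e ∈ blk (d, c, e) := by simp [blk]
    simp only [pt_zero, zero_sub, neg_sub]
    constructor
    · rintro ⟨p, hp, q, hq, hpq⟩
      rw [mem_blk] at hp hq
      rcases hp with rfl | rfl | rfl | rfl <;> rcases hq with rfl | rfl | rfl | rfl <;>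
        simp only [hpq, sub_self, sub_zero, zero_sub, true_or, or_true]
    · rintro (h | (h | h) | (h | h) | (h | h) | (h | h) | (h | h) | (h | h))
      · exact ⟨0, m0, 0, m0, by rw [h, sub_zero]⟩
      · exact ⟨0, m0, _, md, by rw [h, sub_zero]⟩
      · exact ⟨_, md, 0, m0, by rw [h, zero_sub]⟩
      · exact ⟨0, m0, _, mc, by rw [h, sub_zero]⟩
      · exact ⟨_, mc, 0, m0, by rw [h, zero_sub]⟩
      · exact ⟨_, md, _, mc, h⟩
      · exact ⟨_, mc, _, md, h⟩
      · exact ⟨0, m0, _, me, by rw [h, sub_zero]⟩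
      · exact ⟨_, me, 0, m0, by rw [h, zero_sub]⟩
      · exact ⟨_, md, _, me, h⟩
      · exact ⟨_, me, _, md, h⟩
      · exact ⟨_, mc, _, me, h⟩
      · exact ⟨_, me, _, mc, h⟩
  rw [markBlock, hasBit_mark, hasBit_mark, hasBit_mark, hasBit_mark, hasBit_mark, hasBit_mark,
    h x hx]
  simp only [List.mem_cons, exists_eq_or_imp, key]
  generalize (∃ t ∈ ts, ∃ p ∈ blk t, ∃ q ∈ blk t, pt x = q - p) = E
  constructor
  · rintro (((((((h | h) | h) | h) | h) | h) | h) | h) <;> simp only [h, true_or, or_true]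
  · rintro (h | (h | h | h | h | h | h | h) | h) <;> simp only [h, true_or, or_true]

/-- The differences of a block through `0` and a point with an unrecorded code are unrecorded, and
pairwise distinct up to sign. -/
theorem IsInvariantSteiner.unmarked {𝓑 : Finset (Finset Plane)} (h : IsInvariantSteiner 𝓑)
    {U : ℕ} {ts : List (ℕ × ℕ × ℕ)} (hU : Records U ts) (hts : ∀ t ∈ ts, blk t ∈ 𝓑) {d c e : ℕ}
    (hd : d < 49) (hc : c < 49) (he : e < 49) (hB : blk (d, c, e) ∈ 𝓑)
    (hdU : hasBit U d = false) :
    hasBit (mark U d) c = false ∧ hasBit (mark U d) (subC c d) = false ∧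
    hasBit (mark (mark U d) c) (subC c d) = false ∧
    hasBit (mark (mark (mark U d) c) (subC c d)) e = false ∧
    hasBit (mark (mark (mark (mark U d) c) (subC c d)) e) (subC e d) = false ∧
    hasBit (mark (mark (mark (mark (mark U d) c) (subC c d)) e) (subC e d)) (subC e c) = false := by
  obtain ⟨n1, n2, n3, n4, n5, n6⟩ := card_blk.1 (h.steiner.2.1 _ hB)
  have m0 : (0 : Plane) ∈ blk (d, c, e) := by simp [blk]
  have md : pt d ∈ blk (d, c, e) := by simp [blk]
  have mc : pt c ∈ blk (d, c, e) := by simp [blk]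
  have me : pt e ∈ blk (d, c, e) := by simp [blk]
  have hfresh : ∀ {x p q}, x < 49 → pt x = q - p → p ∈ blk (d, c, e) → q ∈ blk (d, c, e) →
      p ≠ q → ¬ hasBit U x = true := by
    intro x p q hx hxe hp hq hpq hbit
    rcases (hU x hx).1 hbit with rfl | ⟨t, ht, p', hp', q', hq', hxe'⟩
    · rw [pt_zero] at hxe
      exact hpq (sub_eq_zero.1 hxe.symm).symm
    · have heq := h.eq_translate hB (hts t ht) hp hq hp' hq' hpq (hxe.symm.trans hxe')
      rw [heq, mem_translateBlock] at m0 md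
      have : hasBit U d = true := (hU d hd).2 (Or.inr ⟨t, ht, _, m0, _, md, by abel⟩)
      rw [hdU] at this
      exact absurd this (by decide)
  have hne : ∀ {x y p q p' q'}, pt x = q - p → pt y = q' - p' → y < 49 →
      p ∈ blk (d, c, e) → q ∈ blk (d, c, e) → p' ∈ blk (d, c, e) → q' ∈ blk (d, c, e) → p ≠ q →
      (p = p' → q ≠ q') → (p = q' → q ≠ p') → ¬ (x = y ∨ x = subC 0 y) := by
    rintro x y p q p' q' hx hy hy49 hp hq hp' hq' hpq h1 h2 (rfl | rfl)
    · have hd := hx.symm.trans hy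
      have hpp := h.left_eq_of_sub_eq hB hp hq hp' hq' hpq hd
      exact h1 hpp (by rw [hpp] at hd; exact sub_left_injective hd)
    · rw [pt_subC 0 hy49, hy, pt_zero, zero_sub, neg_sub] at hx
      have hpp := h.left_eq_of_sub_eq hB hp hq hq' hp' hpq hx.symm
      exact h2 hpp (by rw [hpp] at hx; exact sub_left_injective hx.symm)
  have ed : pt d = pt d - 0 := (sub_zero _).symm
  have ec : pt c = pt c - 0 := (sub_zero _).symm
  have ee : pt e = pt e - 0 := (sub_zero _).symm
  have ecd := pt_subC c hd
  have eed := pt_subC e hd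
  have eec := pt_subC e hc
  have lcd := subC_lt c d
  have led := subC_lt e d
  have fc := hfresh hc ec m0 mc n2.symm
  have fcd := hfresh lcd ecd md mc n4
  have fe := hfresh he ee m0 me n3.symm
  have fed := hfresh led eed md me n5
  have fec := hfresh (subC_lt e c) eec mc me n6
  have cd := hne ec ed hd m0 mc m0 md n2.symm (fun _ => n4.symm) (fun h _ => n1 h.symm)
  have cd_d := hne ecd ed hd md mc m0 md n4 (fun h _ => n1 h) (fun _ => n2)
  have cd_c := hne ecd ec hc md mc m0 mc n4 (fun h _ => n1 h) (fun h _ => n4 h)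
  have e_d := hne ee ed hd m0 me m0 md n3.symm (fun _ => n5.symm) (fun h _ => n1 h.symm)
  have e_c := hne ee ec hc m0 me m0 mc n3.symm (fun _ => n6.symm) (fun h _ => n2 h.symm)
  have e_cd := hne ee ecd lcd m0 me md mc n3.symm (fun h _ => n1 h.symm) (fun h _ => n2 h.symm)
  have ed_d := hne eed ed hd md me m0 md n5 (fun h _ => n1 h) (fun _ => n3)
  have ed_c := hne eed ec hc md me m0 mc n5 (fun h _ => n1 h) (fun h _ => n4 h)
  have ed_cd := hne eed ecd lcd md me md mc n5 (fun _ => n6.symm) (fun h _ => n4 h)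
  have ed_e := hne eed ee he md me m0 me n5 (fun h _ => n1 h) (fun h _ => n5 h)
  have ec_d := hne eec ed hd mc me m0 md n6 (fun h _ => n2 h) (fun h _ => n4 h.symm)
  have ec_c := hne eec ec hc mc me m0 mc n6 (fun h _ => n2 h) (fun _ => n3)
  have ec_cd := hne eec ecd lcd mc me md mc n6 (fun h _ => n4 h.symm) (fun _ => n5.symm)
  have ec_e := hne eec ee he mc me m0 me n6 (fun h _ => n2 h) (fun h _ => n6 h)
  have ec_ed := hne eec eed led mc me md me n6 (fun h _ => n4 h.symm) (fun h _ => n6 h)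
  simp only [← Bool.not_eq_true, hasBit_mark, fc, fcd, fe, fed, fec, cd, cd_d, cd_c, e_d, e_c,
    e_cd, ed_d, ed_c, ed_cd, ed_e, ec_d, ec_c, ec_cd, ec_e, ec_ed,
    Bool.false_eq_true, or_self, not_false_eq_true, and_self]

/-! ### The exhaustive search -/

/-- Continues with `k` after marking `x`, unless `x` is marked already. -/
def place (U x : ℕ) (k : ℕ → Bool) : Bool :=
  force x fun x => cond (hasBit U x) true (force (mark U x) k)

theorem place_spec {U x : ℕ} {k : ℕ → Bool} (h : place U x k = true) (hx : hasBit U x = false) :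
    k (mark U x) = true := by
  rwa [place, force_eq, hx, cond_false, force_eq] at h

/-- The points `c < n` such that `c` and `c - d` are unmarked. -/
def freePoints (U d n : ℕ) : List ℕ :=
  Nat.rec [] (fun m r => cond (hasBit U m) r (cond (hasBit U (subC m d)) r (m :: r))) n

theorem mem_freePoints {U d n c : ℕ} (hc : c < n) (h1 : hasBit U c = false)
    (h2 : hasBit U (subC c d) = false) : c ∈ freePoints U d n := by
  induction n with
  | zero => omega
  | succ n ih =>
    change c ∈ cond (hasBit U n) (freePoints U d n)
      (cond (hasBit U (subC n d)) (freePoints U d n) (n :: freePoints U d n))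
    rcases Nat.lt_succ_iff_lt_or_eq.1 hc with hc | rfl
    · cases hasBit U n <;> cases hasBit U (subC n d) <;> simp [ih hc]
    · simp [h1, h2]

/-- Tests `f` on each member of the list together with the tail that follows it. -/
def allTails (f : ℕ → List ℕ → Bool) : List ℕ → Bool
  | [] => true
  | c :: t => cond (f c t) (allTails f t) false

theorem allTails_spec {f : ℕ → List ℕ → Bool} {l : List ℕ} (h : allTails f l = true) {a b : ℕ}
    (ha : a ∈ l) (hb : b ∈ l) (hab : a ≠ b) :
    (∃ t, f a t = true ∧ b ∈ t) ∨ ∃ t, f b t = true ∧ a ∈ t := by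
  induction l with
  | nil => simp at ha
  | cons c l ih =>
    rw [allTails] at h
    have hf : f c l = true := by
      cases hf : f c l
      · rw [hf] at h; exact absurd h Bool.false_ne_true
      · rfl
    rw [hf, cond_true] at h
    rcases List.mem_cons.1 ha with rfl | ha'
    · exact Or.inl ⟨l, hf, (List.mem_cons.1 hb).resolve_left hab.symm⟩
    · rcases List.mem_cons.1 hb with rfl | hb'
      · exact Or.inr ⟨l, hf, ha'⟩
      · exact ih h ha' hb'

/-- Tests `k` on all blocks `blk (d, c, e)` whose differences are unmarked and distinct up to sign.
The first argument of `k` is the mask after marking the differences of the block. -/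
def expand (U d : ℕ) (k : ℕ → ℕ → ℕ → Bool) : Bool :=
  force (mark U d) fun U₀ => allTails (fun c t =>
    place U₀ c fun U₁ => place U₁ (subC c d) fun U₂ => t.all fun e =>
      place U₂ e fun U₃ => place U₃ (subC e d) fun U₄ => place U₄ (subC e c) fun U₅ => k U₅ c e)
    (freePoints U₀ d 49)

/-- The system contains a block through `0` and the unrecorded point `d`, and `expand` examines it:
its points `c` and `e` are free and occur, in one of the two orders, in the list of free points. -/
theorem IsInvariantSteiner.exists_of_expand {𝓑 : Finset (Finset Plane)}
    (h : IsInvariantSteiner 𝓑) {U : ℕ} {ts : List (ℕ × ℕ × ℕ)} (hU : Records U ts)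
    (hts : ∀ t ∈ ts, blk t ∈ 𝓑) {d : ℕ} (hd : d < 49) (hdU : hasBit U d = false)
    {k : ℕ → ℕ → ℕ → Bool} (hk : expand U d k = true) :
    ∃ c e, c < 49 ∧ e < 49 ∧ blk (d, c, e) ∈ 𝓑 ∧ Records (markBlock U d c e) ((d, c, e) :: ts) ∧
      k (markBlock U d c e) c e = true := by
  have hd0 : d ≠ 0 := by
    rintro rfl
    have := (hU 0 hd).2 (Or.inl rfl)
    rw [hdU] at this
    exact absurd this (by decide)
  obtain ⟨B, ⟨hB, h0B, hdB⟩, -⟩ := h.steiner.2.2 0 (pt d) (pt_ne_zero hd hd0).symm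
  obtain ⟨c, e, hc, he, hce, rfl⟩ :=
    exists_blk_eq (h.steiner.2.1 B hB) h0B hdB (pt_ne_zero hd hd0)
  have hB' : blk (d, e, c) ∈ 𝓑 := by
    rwa [show blk (d, e, c) = blk (d, c, e) by ext x; simp only [mem_blk]; tauto]
  obtain ⟨c1, c2, c3, c4, c5, c6⟩ := h.unmarked hU hts hd hc he hB hdU
  obtain ⟨e1, e2, e3, e4, e5, e6⟩ := h.unmarked hU hts hd he hc hB' hdU
  rw [expand, force_eq] at hk
  rcases allTails_spec hk (mem_freePoints hc c1 c2) (mem_freePoints he e1 e2) hce with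
    ⟨t, ht, hm⟩ | ⟨t, ht, hm⟩
  · have h1 := place_spec ht c1
    have h2 := List.all_eq_true.1 (place_spec h1 c3) e hm
    have h3 := place_spec h2 c4
    have h4 := place_spec h3 c5
    exact ⟨c, e, hc, he, hB, hU.cons hd hc he, place_spec h4 c6⟩
  · have h1 := place_spec ht e1
    have h2 := List.all_eq_true.1 (place_spec h1 e3) c hm
    have h3 := place_spec h2 e4
    have h4 := place_spec h3 e5
    exact ⟨e, c, he, hc, hB', hU.cons hd he hc, place_spec h4 e6⟩

/-- The largest unmarked code below `n`, or `0` if there is none. -/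
def lastFree (U n : ℕ) : ℕ := Nat.rec 0 (fun m r => cond (hasBit U m) r m) n

theorem lastFree_lt (U : ℕ) {n : ℕ} (hn : 0 < n) : lastFree U n < n := by
  have : ∀ n, lastFree U n < n + 1 := by
    intro n
    induction n with
    | zero => exact Nat.zero_lt_one
    | succ n ih =>
      change cond (hasBit U n) (lastFree U n) n < n + 1 + 1
      cases hasBit U n
      · simp
      · exact ih.trans (Nat.lt_succ_self _)
  obtain ⟨m, rfl⟩ := Nat.exists_eq_succ_of_ne_zero hn.ne'
  change cond (hasBit U m) (lastFree U m) m < m + 1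
  cases hasBit U m
  · simp
  · exact this m

/-- Adds `n` blocks to those in the list `ts` in all ways that keep the differences distinct. The
test fails unless each list of blocks obtained covers all differences, that is, the mask has reached
`2 ^ 49 - 1`, and satisfies `leaf`. -/
def search (leaf : List (ℕ × ℕ × ℕ) → Bool) : ℕ → ℕ → List (ℕ × ℕ × ℕ) → Bool
  | 0, U, ts => cond (Nat.beq U 562949953421311) (leaf ts) false
  | n + 1, U, ts => force (lastFree U 49) fun d => cond (hasBit U d) false <|
      expand U d fun U c e => search leaf n U ((d, c, e) :: ts)

/-- A successful search reaches a list of blocks of the system whose differences exhaust the nonzero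
elements and which satisfies `leaf`. -/
theorem IsInvariantSteiner.exists_of_search {𝓑 : Finset (Finset Plane)}
    (h : IsInvariantSteiner 𝓑) {leaf : List (ℕ × ℕ × ℕ) → Bool} {n U : ℕ}
    {ts : List (ℕ × ℕ × ℕ)} (hU : Records U ts) (hts : ∀ t ∈ ts, blk t ∈ 𝓑)
    (hs : search leaf n U ts = true) :
    ∃ ts', leaf ts' = true ∧ (∀ t ∈ ts', blk t ∈ 𝓑) ∧
      ∀ x : Plane, x ≠ 0 → ∃ t ∈ ts', ∃ p ∈ blk t, ∃ q ∈ blk t, x = q - p := by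
  induction n generalizing U ts with
  | zero =>
    rw [search] at hs
    cases hfull : Nat.beq U 562949953421311
    · rw [hfull] at hs; exact absurd hs Bool.false_ne_true
    rw [hfull, cond_true] at hs
    refine ⟨ts, hs, hts, fun x hx => ?_⟩
    have hbit : ∀ x < 49, hasBit 562949953421311 x = true := by decide
    have hx0 : code x ≠ 0 := fun h0 => hx (by rw [← pt_code x, h0, pt_zero])
    have hb := hbit _ (code_lt x)
    rw [← Nat.eq_of_beq_eq_true hfull, hU _ (code_lt x), pt_code] at hb
    exact hb.resolve_left hx0
  | succ n ih =>
    rw [search, force_eq] at hs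
    cases hb : hasBit U (lastFree U 49)
    · rw [hb, cond_false] at hs
      obtain ⟨c, e, -, -, hB, hR, hk⟩ :=
        h.exists_of_expand hU hts (lastFree_lt U (by norm_num)) hb hs
      refine ih hR (fun t ht => ?_) hk
      rcases List.mem_cons.1 ht with rfl | ht
      · exact hB
      · exact hts t ht
    · rw [hb] at hs; exact absurd hs Bool.false_ne_true

/-! ### Completeness of the list -/

/-- The triples `(T, u, v)` such that the automorphism given by `u` and `v` maps `blk root` to a
block of the development of a listed family with the line table `T`. -/
def candidates (root : ℕ × ℕ × ℕ) : List (ℕ × ℕ × ℕ) :=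
  (List.finRange 12).flatMap fun i => force (listedTable i) fun T =>
    (List.range 49).flatMap fun v => [third T v, fourth T v].flatMap fun u =>
      cond (dependent u v) [] (cond (mapsInto T u v root) [(T, u, v)] [])

theorem exists_of_mem_candidates {root a : ℕ × ℕ × ℕ} (h : a ∈ candidates root) :
    ∃ i, a.1 = listedTable i ∧ dependent a.2.1 a.2.2 = false := by
  simp only [candidates, force_eq, List.mem_flatMap] at h
  obtain ⟨i, -, v, -, u, -, ha⟩ := h
  cases hdep : dependent u v
  · rw [hdep, cond_false] at ha
    cases hm : mapsInto (listedTable i) u v root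
    · rw [hm] at ha; exact absurd ha List.not_mem_nil
    · rw [hm, cond_true, List.mem_singleton] at ha
      subst ha
      exact ⟨i, rfl, hdep⟩
  · rw [hdep] at ha; exact absurd ha List.not_mem_nil

/-- Tests whether a candidate maps all blocks `blk t`, `t ∈ ts`, to blocks. -/
def isListed (cands ts : List (ℕ × ℕ × ℕ)) : Bool :=
  cands.any fun a => ts.all (mapsInto a.1 a.2.1 a.2.2)

/-- Representatives of the quadrilaterals `0`, `(0, 1)`, `(1, 0)`, `p` up to affine equivalence,
given by the code of `p`. Only those with `12` distinct differences are needed. -/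
def rootPoints : List ℕ := [16, 27, 9, 3]

/-- Tests whether some affine map sends a block `blk (1, 7, p)` with `p` in `rootPoints` to the
block with the codes `0`, `1`, `c`, `e`. -/
def isAffineRoot (c e : ℕ) : Bool :=
  rootPoints.any fun p => [0, 1, c, e].any fun a => [0, 1, c, e].any fun v =>
    [0, 1, c, e].any fun u => force (subC u a) fun u => force (subC v a) fun v =>
      cond (dependent u v) false (cond (oneOf 0 1 (addC (app u v p) a)) true
        (oneOf c e (addC (app u v p) a)))

theorem expand_root : expand 1 1 (fun _ c e => isAffineRoot c e) = true := by
  decide +kernel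

theorem search_rootPoints (p : ℕ) (hp : p ∈ rootPoints) :
    force (markBlock 1 1 7 p) (fun U =>
      search (isListed (candidates (1, 7, p))) 3 U [(1, 7, p)]) = true := by
  revert p
  decide +kernel

theorem card_blk_root {p : ℕ} (hp : p ∈ rootPoints) : #(blk (1, 7, p)) = 4 := by
  revert p
  decide

theorem root_lt {p : ℕ} (hp : p ∈ rootPoints) : p < 49 := by
  revert p
  decide

/-- Up to an automorphism, the system contains a block `blk (1, 7, p)` with `p` in `rootPoints`. -/
theorem IsInvariantSteiner.exists_mapBlocks_root {𝓑 : Finset (Finset Plane)}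
    (h : IsInvariantSteiner 𝓑) :
    ∃ α : Plane ≃+ Plane, ∃ p ∈ rootPoints, (blk (1, 7, p)).image α ∈ 𝓑 := by
  have hbit : hasBit 1 1 = false := by decide
  obtain ⟨c, e, hc, he, hB, -, hk⟩ :=
    h.exists_of_expand records_one (by simp) (by norm_num) hbit expand_root
  simp only [isAffineRoot, List.any_eq_true, force_eq] at hk
  obtain ⟨p, hp, a, ha, v, hv, u, hu, hk⟩ := hk
  have hmem : ∀ z ∈ [0, 1, c, e], pt z ∈ blk (1, c, e) := by
    intro z hz
    simp only [List.mem_cons, List.not_mem_nil, or_false] at hz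
    rcases hz with rfl | rfl | rfl | rfl <;> simp [blk]
  have ha49 : a < 49 := by
    simp only [List.mem_cons, List.not_mem_nil, or_false] at ha
    rcases ha with rfl | rfl | rfl | rfl <;> first | assumption | norm_num
  cases hdep : dependent (subC u a) (subC v a)
  swap
  · rw [hdep] at hk; exact absurd hk Bool.false_ne_true
  have hdet := (dependent_eq_false _ _).1 hdep
  have hw : addC (app (subC u a) (subC v a) p) a ∈ [0, 1, c, e] := by
    have h1 := oneOf_eq 0 1 (addC (app (subC u a) (subC v a) p) a)
    have h2 := oneOf_eq c e (addC (app (subC u a) (subC v a) p) a)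
    simp only [List.mem_cons, List.not_mem_nil, or_false]
    rw [hdep, cond_false] at hk
    cases h3 : oneOf 0 1 (addC (app (subC u a) (subC v a) p) a)
    · rw [h3, cond_false] at hk
      exact Or.inr (Or.inr (h2.1 hk))
    · rcases h1.1 h3 with h | h
      · exact Or.inl h
      · exact Or.inr (Or.inl h)
  -- The image of the root block, translated by `a`, has the points `a`, `v`, `u`, and one more.
  have himg : translateBlock ((blk (1, 7, p)).image (matAut _ _ hdet)) (pt a) = blk (1, c, e) := by
    refine eq_of_subset_of_card_le (fun x hx => ?_) ?_
    · rw [mem_translateBlock, mem_image] at hx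
      obtain ⟨z, hz, hzx⟩ := hx
      rw [← sub_add_cancel x (pt a), ← hzx, matAut_apply]
      have e1 : pt 1 = (0, 1) := by decide
      have e7 : pt 7 = (1, 0) := by decide
      rcases mem_blk.1 hz with rfl | rfl | rfl | rfl
      · rw [map_zero, zero_add]; exact hmem a ha
      · have : matHom (pt (subC u a)) (pt (subC v a)) (pt 1) = pt (subC v a) := by
          rw [e1, matHom_apply]; simp
        rw [this, pt_subC v ha49, sub_add_cancel]; exact hmem v hv
      · have : matHom (pt (subC u a)) (pt (subC v a)) (pt 7) = pt (subC u a) := by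
          rw [e7, matHom_apply]; simp
        rw [this, pt_subC u ha49, sub_add_cancel]; exact hmem u hu
      · rw [← pt_app, ← pt_addC]; exact hmem _ hw
    · rw [card_translateBlock, card_image_of_injective _ (AddEquiv.injective _), card_blk_root hp]
      exact card_blk_le _
  refine ⟨matAut _ _ hdet, p, hp, ?_⟩
  have hm := h.translate_mem _ hB (-pt a)
  rw [← himg] at hm
  convert hm using 1
  ext x
  simp [mem_translateBlock]

theorem IsInvariantSteiner.exists_listed {𝓑 : Finset (Finset Plane)}
    (h : IsInvariantSteiner 𝓑) {p : ℕ} (hp : p ∈ rootPoints) (hB : blk (1, 7, p) ∈ 𝓑) :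
    ∃ i, ∃ α : Plane ≃+ Plane, ∀ B ∈ 𝓑, B.image α ∈ development (listedFamilies i).family := by
  have hs := search_rootPoints p hp
  rw [force_eq] at hs
  obtain ⟨ts, hleaf, hts, hcov⟩ := h.exists_of_search
    (records_one.cons (by norm_num) (by norm_num) (root_lt hp)) (by simpa using hB) hs
  obtain ⟨⟨T, u, v⟩, ha, hall⟩ := List.any_eq_true.1 hleaf
  obtain ⟨i, rfl : T = listedTable i, hdep⟩ := exists_of_mem_candidates ha
  have hdet := (dependent_eq_false u v).1 hdep
  have hS := listedFamilies_isInvariantSteiner i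
  refine ⟨i, matAut (pt u) (pt v) hdet, fun B hBm => ?_⟩
  obtain ⟨x, hx, y, hy, hxy⟩ := one_lt_card.1
    ((by norm_num : 1 < 4).trans_eq (h.steiner.2.1 B hBm).symm)
  obtain ⟨t, ht, x', hx', y', hy', hd⟩ := hcov (y - x) (sub_ne_zero.2 hxy.symm)
  rw [h.eq_translate hBm (hts t ht) hx hy hx' hy' hxy hd, translateBlock_image]
  exact hS.translate_mem _ ((mapsInto_iff (listedTable_spec i).2.2 hS.steiner hdet
    (h.steiner.2.1 _ (hts t ht))).1 (List.all_eq_true.1 hall t ht)) _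

theorem exists_multiplierEquivalent_listed {F : Finset (Finset Plane)}
    (hF : IsDifferenceFamily 49 4 F) : ∃ i, MultiplierEquivalent F (listedFamilies i).family := by
  have h := hF.isInvariantSteiner
  obtain ⟨β, p, hp, hm⟩ := h.exists_mapBlocks_root
  have hroot : blk (1, 7, p) ∈ mapBlocks β.symm (development F) :=
    mem_mapBlocks.2 ⟨_, hm, by rw [image_image]; simp⟩
  obtain ⟨i, α, hα⟩ := (h.mapBlocks β.symm).exists_listed hp hroot
  refine ⟨i, β.symm.trans α, (development_mapBlocks_eq_iff hF
    (listedFamilies_isInvariantSteiner i) _).2 fun B hB => ?_⟩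
  have hBm : B.image β.symm ∈ mapBlocks β.symm (development F) :=
    mem_mapBlocks.2 ⟨B, mem_development.2 ⟨B, hB, 0, by simp [translateBlock]⟩, rfl⟩
  have := hα _ hBm
  rwa [image_image] at this

theorem mainTheorem10 :
    -- the listed families are difference families, and they generate Steiner systems
    (∀ i, IsDifferenceFamily 49 4 (listedFamilies i).family) ∧
    (∀ i, IsSteinerSystem 49 4 (development (listedFamilies i).family)) ∧
    -- they have the stated multipliers and fingerprints
    (∀ i, multiplierNumber (listedFamilies i).family = (listedFamilies i).multiplier) ∧
    (∀ i n, hyperbolicFrequency (development (listedFamilies i).family) n =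
      (listedFamilies i).frequency n) ∧
    -- the list is complete up to multiplier-equivalence
    (∀ F : Finset (Finset (ZMod 7 × ZMod 7)), IsDifferenceFamily 49 4 F →
      ∃ i, MultiplierEquivalent F (listedFamilies i).family) ∧
    -- the listed families are pairwise multiplier-inequivalent
    (∀ i j, i ≠ j →
      ¬ MultiplierEquivalent (listedFamilies i).family (listedFamilies j).family) ∧
    -- and the Steiner systems they generate are pairwise non-isomorphic
    (∀ i j, i ≠ j → ¬ BlocksIsomorphic (development (listedFamilies i).family)
      (development (listedFamilies j).family)) :=
  ⟨listedFamilies_isDifferenceFamily, fun i => (listedFamilies_isInvariantSteiner i).steiner,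
    listedFamilies_multiplierNumber, listedFamilies_hyperbolicFrequency,
    fun _ hF => exists_multiplierEquivalent_listed hF, not_multiplierEquivalent_listed,
    not_blocksIsomorphic_listed⟩
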